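/- **Theorem (Immediate Optimality under Many Observations).** Let $K\ge 1$ and let the persistent state vector $\theta=(\theta_1,\dots,\theta_K)'$ have a Gaussian prior $\mathcal N(\mu^0,V^0)$ with $V^0$ positive definite; $\theta_1$ is the payoff-relevant state. There are $K$ information sources. Each observation of source $k$ is an independent realization of $$X_k=\langle c_k,\theta\rangle+\epsilon_k,\qquad \epsilon_k\sim\mathcal N(0,\sigma_k^2),\quad \sigma_k^2>0,$$ where all noise terms are independent of each other and of $\theta$. Assume that the signal structure is non-redundant: the $K\times K$ matrix $C$ with rows $c_1',\dots,c_K'$ has full rank, and no proper subset of its rows spans the coordinate vector $e_1'$. In each period $t=1,2,\dots$ a decision-maker (DM) first chooses a multiset of $B$ sources, observes the resulting $B$ realizations, and then takes an action $a_t$ in a measurable space $A_t$. An information acquisition strategy maps, measurably, the signal realizations of the earlier periods to a multiset of $B$ sources; a decision strategy maps, measurably, the realizations up to and including period $t$ to an action $a_t\in A_t$. The DM's payoff is $U(a_1,a_2,\dots;\theta_1)$, where $U$ is an arbitrary real-valued measurable function, and a strategy (a pair of an information acquisition strategy and a decision strategy) is evaluated by its expected payoff in $[-\infty,\infty]$ (equal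 to $-\infty$ if the positive and the negative part of the payoff both have infinite expectation). A strategy is optimal if no other strategy has a higher expected payoff. An information acquisition strategy is myopic if in every period it chooses $B$ sources that, combined with the history of observations, lead almost surely to the lowest posterior variance of $\theta_1$ at the end of the period. Then there is a number $B_0$, depending only on $\mu^0$, $V^0$, $C$ and $\sigma_1^2,\dots,\sigma_K^2$, such that for every $B\ge B_0$ there is a myopic, history-independent information acquisition strategy $S^*$ that is optimal for all decision problems: for all action spaces $(A_t)_{t\ge1}$ and every payoff function $U$, 1. for every strategy $(S,D)$ there is a decision strategy $D^*$ such that the expected payoff of $(S^*,D^*)$ is at least that of $(S,D)$; 2. in particular, if an optimal strategy exists, then there is an optimal strategy whose information acquisition strategy is $S^*$. -/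

import Mathlib

open MeasureTheory ProbabilityTheory
open scoped NNReal ENNReal Matrix

noncomputable section

namespace MyopicInfo

/-- An informational environment with `K` persistent states and `K` sources: the Gaussian prior
`N(mean, cov)` over the state vector, the matrix `C` whose `k`-th row holds the coefficients of
source `k`, and the noise variances of the sources. The payoff-relevant state is coordinate `0`. -/
structure Environment (K : ℕ) where
  mean : EuclideanSpace ℝ (Fin K)
  cov : Matrix (Fin K) (Fin K) ℝ
  cov_posDef : cov.PosDef
  C : Matrix (Fin K) (Fin K) ℝ
  noiseVar : Fin K → ℝ≥0
  noiseVar_pos : ∀ k, 0 < noiseVar k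

/-- `C` has full rank and no proper subset of its rows spans the first coordinate vector. -/
def Environment.NonRedundant {K : ℕ} [NeZero K] (E : Environment K) : Prop :=
  E.C.rank = K ∧
    ∀ s : Set (Fin K), s ≠ Set.univ →
      (Pi.single 0 1 : Fin K → ℝ) ∉ Submodule.span ℝ (E.C.row '' s)

/-- A multiset of `B` sources, given by the multiplicity of each source. -/
abbrev Block (K B : ℕ) : Type := {q : Fin K → ℕ // ∑ k, q k = B}

/-- The signal realizations of one period. Entry `(k, j)` is the `j`-th observation of source `k`
in that period; entries that are not observed are recorded as `0`. -/
abbrev Obs (K B : ℕ) : Type := Fin K → Fin B → ℝ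

/-- An outcome: the state vector and all noise terms, where `(t, k, j)` indexes the noise in the
`j`-th observation of source `k` in period `t`. -/
abbrev Outcome (K B : ℕ) : Type := EuclideanSpace ℝ (Fin K) × (ℕ × Fin K × Fin B → ℝ)

/-- The law of the states and the noise terms: the states have the prior distribution, and the
noise terms are independent centred Gaussians, independent of the states. -/
def Environment.law {K : ℕ} (E : Environment K) (B : ℕ) : Measure (Outcome K B) :=
  (multivariateGaussian E.mean E.cov).prod
    (Measure.infinitePi fun i : ℕ × Fin K × Fin B => gaussianReal 0 (E.noiseVar i.2.1))

/-- The realizations produced in period `t` by choosing the multiset `q`: observations of source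
`k` have the form `⟨c_k, θ⟩ + ε`. -/
def Environment.signal {K B : ℕ} (E : Environment K) (q : Block K B) (t : ℕ)
    (ω : Outcome K B) : Obs K B :=
  fun k j => if (j : ℕ) < q.1 k then (∑ i, E.C k i * ω.1 i) + ω.2 (t, k, j) else 0

/-- An information acquisition strategy: the multiset chosen in period `t` (periods are numbered
from `0`) is a measurable function of the realizations of the `t` earlier periods. -/
structure AcqStrategy (K B : ℕ) where
  acquire : (t : ℕ) → (Fin t → Obs K B) → Block K B
  measurable_acquire : ∀ t, Measurable (acquire t)

/-- The history-independent strategy that follows a fixed path of multisets. -/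
def AcqStrategy.ofPath {K B : ℕ} (p : ℕ → Block K B) : AcqStrategy K B where
  acquire t _ := p t
  measurable_acquire _ := measurable_const

/-- The strategy that chooses `q` in period `t` and otherwise agrees with `S`. -/
def AcqStrategy.deviate {K B : ℕ} (S : AcqStrategy K B) (t : ℕ) (q : Block K B) :
    AcqStrategy K B where
  acquire s h := if s = t then q else S.acquire s h
  measurable_acquire s := by
    by_cases hs : s = t
    · simp only [hs, if_true]; exact measurable_const
    · simp only [hs, if_false]; exact S.measurable_acquire s

/-- The realizations observed in the first `t` periods under `S`. -/
def AcqStrategy.history {K B : ℕ} (S : AcqStrategy K B) (E : Environment K) :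
    (t : ℕ) → Outcome K B → (Fin t → Obs K B)
  | 0, _ => Fin.elim0
  | t + 1, ω =>
      Fin.snoc (α := fun _ => Obs K B) (S.history E t ω)
        (E.signal (S.acquire t (S.history E t ω)) t ω)

/-- The posterior variance of the payoff-relevant state after the first `t` periods under `S`, as
a random variable: its variance conditional on the observed history. -/
def AcqStrategy.posteriorVariance {K B : ℕ} [NeZero K] (S : AcqStrategy K B)
    (E : Environment K) (t : ℕ) : Outcome K B → ℝ :=
  condVar (MeasurableSpace.comap (S.history E t) inferInstance) (fun ω => ω.1 0) (E.law B)

/-- `S` is myopic: in every period the multiset that it chooses leads, combined with the history of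
earlier observations, to a posterior variance at the end of the period that is no larger than
after any other choice of `B` sources in that period. -/
def AcqStrategy.IsMyopic {K B : ℕ} [NeZero K] (S : AcqStrategy K B) (E : Environment K) : Prop :=
  ∀ (t : ℕ) (q : Block K B),
    S.posteriorVariance E (t + 1) ≤ᵐ[E.law B] (S.deviate t q).posteriorVariance E (t + 1)

/-- A decision strategy: the action in period `t`, a measurable function of the realizations up to
and including period `t`. -/
structure DecisionStrategy (K B : ℕ) (A : ℕ → Type*) [∀ t, MeasurableSpace (A t)] where
  act : (t : ℕ) → (Fin (t + 1) → Obs K B) → A t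
  measurable_act : ∀ t, Measurable (act t)

/-- The realized payoff when information is acquired according to `S`, actions are taken according
to `D`, and the payoff function is `U`. -/
def payoff {K B : ℕ} [NeZero K] (E : Environment K) {A : ℕ → Type*} [∀ t, MeasurableSpace (A t)]
    (U : (∀ t, A t) → ℝ → ℝ) (S : AcqStrategy K B) (D : DecisionStrategy K B A)
    (ω : Outcome K B) : ℝ :=
  U (fun t => D.act t (S.history E (t + 1) ω)) (ω.1 0)

/-- The expected payoff in `[-∞, ∞]`, as the expectation of the positive part minus that of the
negative part. If both are infinite, the value is `-∞`. -/
def expectedPayoff {K B : ℕ} [NeZero K] (E : Environment K) {A : ℕ → Type*}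
    [∀ t, MeasurableSpace (A t)] (U : (∀ t, A t) → ℝ → ℝ) (S : AcqStrategy K B)
    (D : DecisionStrategy K B A) : EReal :=
  ((∫⁻ ω, ENNReal.ofReal (payoff E U S D ω) ∂E.law B : ℝ≥0∞) : EReal) -
    ((∫⁻ ω, ENNReal.ofReal (-payoff E U S D ω) ∂E.law B : ℝ≥0∞) : EReal)

/-- The pair `(S, D)` is optimal among all pairs of an information acquisition strategy and a
decision strategy. -/
def IsOptimal {K B : ℕ} [NeZero K] (E : Environment K) {A : ℕ → Type*}
    [∀ t, MeasurableSpace (A t)] (U : (∀ t, A t) → ℝ → ℝ) (S : AcqStrategy K B)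
    (D : DecisionStrategy K B A) : Prop :=
  ∀ (S' : AcqStrategy K B) (D' : DecisionStrategy K B A),
    expectedPayoff E U S' D' ≤ expectedPayoff E U S D

end MyopicInfo

end

open MyopicInfo

/-! Non-redundancy makes `E.C` invertible and gives θ₁ = ∑ w_k η_k with η = Cθ and every w_k
nonzero. In these coordinates source k observes η_k itself, so after q_k observations of each source
the posterior variance is the deterministic number w'(P + diag(q_k / σ_k²))⁻¹w, where P is the prior
precision of η. Two facts carry the theorem.

Large blocks make the optimal allocations nested. An exchange argument (`exists_pairwise_bound`)
shows that the best allocation of n observations is proportional to σ_k|w_k| up to an error bounded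
uniformly in n. From n = Bt to n = B(t + 1) the ideal number of observations of each source grows in
proportion to B, which exceeds the errors once B is large. The minimizers are then monotone in t
(`exists_monotone_isMinAlloc`), so one deterministic path attains the lowest variance at every date
at once; in particular it is myopic.

A path with the lowest variance at every date is dynamically more informative about θ₁ than any
strategy. Along a fixed path Q, everything is centred Gaussian after subtracting means, so a copy of
the observations with the correct joint law with θ₁ only has to reproduce inner products in L². It
is built one observation at a time from the current best estimator under the optimal path and a
fresh independent normal variable. The step is possible because the residual of that estimator is no
larger than the distance from θ₁ to the span of the observations along Q (`exists_gram_extension`).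
The copy never looks ahead, in the realizations or in the choices, so equality of laws along fixed
paths extends to adaptive strategies by partitioning according to the choices made
(`map_adapted_eq`).

Decision strategies are deterministic, so the randomness for the copies must come from the history.
The difference of two observations of one source in the first period is pure noise, independent of
the target and of all the estimators, and it can be transformed into an i.i.d. normal sequence. -/

namespace MyopicInfo

/-! ### Posterior variance as a function of the precisions of the observations -/

section PosteriorVariance

lemma dotProduct_mulVec_self_nonneg {κ : Type*} [Fintype κ] {P : Matrix κ κ ℝ}
    (hP : P.PosDef) (x : κ → ℝ) :
    0 ≤ x ⬝ᵥ P *ᵥ x := by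
  simpa using hP.posSemidef.dotProduct_mulVec_nonneg x

lemma posDef_add_diagonal {κ : Type*} [DecidableEq κ] {P : Matrix κ κ ℝ} {l : κ → ℝ}
    (hP : P.PosDef) (hl : ∀ k, 0 ≤ l k) :
    (P + Matrix.diagonal l).PosDef :=
  hP.add_posSemidef (Matrix.PosSemidef.diagonal hl)

variable {κ : Type*} [Fintype κ] [DecidableEq κ]

/-- The variance of `⟨w, η⟩` when `η` has precision matrix `P + diag l`. -/
noncomputable def precVar (P : Matrix κ κ ℝ) (w l : κ → ℝ) : ℝ :=
  w ⬝ᵥ (P + Matrix.diagonal l)⁻¹ *ᵥ w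

variable {P : Matrix κ κ ℝ} {w l : κ → ℝ}

lemma add_diagonal_mulVec_inv_mulVec (hP : P.PosDef) (hl : ∀ k, 0 ≤ l k) (v : κ → ℝ) :
    (P + Matrix.diagonal l) *ᵥ ((P + Matrix.diagonal l)⁻¹ *ᵥ v) = v := by
  rw [Matrix.mulVec_mulVec, Matrix.mul_nonsing_inv _ (posDef_add_diagonal hP hl).det_pos.ne'.isUnit,
    Matrix.one_mulVec]

lemma inv_mulVec_eq (hP : P.PosDef) (hl : ∀ k, 0 ≤ l k) {v x : κ → ℝ} (h : (P + Matrix.diagonal l) *ᵥ x = v) :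
    (P + Matrix.diagonal l)⁻¹ *ᵥ v = x := by
  rw [← h, Matrix.mulVec_mulVec, Matrix.nonsing_inv_mul _
    (posDef_add_diagonal hP hl).det_pos.ne'.isUnit,
    Matrix.one_mulVec]

lemma add_diagonal_mulVec_apply (x : κ → ℝ) (k : κ) :
    ((P + Matrix.diagonal l) *ᵥ x) k = (P *ᵥ x) k + l k * x k := by
  rw [Matrix.add_mulVec, Pi.add_apply, Matrix.mulVec_diagonal]

lemma dotProduct_add_diagonal_mulVec (x : κ → ℝ) :
    x ⬝ᵥ (P + Matrix.diagonal l) *ᵥ x = x ⬝ᵥ P *ᵥ x + ∑ k, l k * x k ^ 2 := by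
  rw [Matrix.add_mulVec, dotProduct_add]
  congr 1
  simp only [dotProduct, Matrix.mulVec_diagonal]
  exact Finset.sum_congr rfl fun k _ => by ring

lemma dotProduct_mulVec_comm (hP : P.PosDef) (hl : ∀ k, 0 ≤ l k) (x y : κ → ℝ) :
    x ⬝ᵥ (P + Matrix.diagonal l) *ᵥ y = y ⬝ᵥ (P + Matrix.diagonal l) *ᵥ x := by
  have h : (P + Matrix.diagonal l)ᵀ = P + Matrix.diagonal l := by
    simpa using (posDef_add_diagonal hP hl).isHermitian.eq
  rw [Matrix.dotProduct_mulVec, ← Matrix.mulVec_transpose, h, dotProduct_comm]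

/-- Pairing the equation (P + diag l) x = w with x gives w·x = x'Px + ∑ l x², and the first term is
nonnegative. -/
lemma sum_mul_sq_le_precVar (hP : P.PosDef) (hl : ∀ k, 0 ≤ l k) :
    ∑ k, l k * ((P + Matrix.diagonal l)⁻¹ *ᵥ w) k ^ 2 ≤ precVar P w l := by
  set x := (P + Matrix.diagonal l)⁻¹ *ᵥ w with hx
  have h1 := dotProduct_add_diagonal_mulVec (P := P) (l := l) x
  rw [add_diagonal_mulVec_inv_mulVec hP hl, dotProduct_comm] at h1
  have := dotProduct_mulVec_self_nonneg hP x
  rw [precVar, ← hx]; linarith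

/-- Cauchy–Schwarz for the form A = P + diag l, applied to x and the k-th unit vector. The left side
is the variance that would remain if all coordinates other than k were known, so a rarely observed
source keeps the total variance high. -/
lemma sq_div_le_precVar (hP : P.PosDef) (hl : ∀ k, 0 ≤ l k) (k : κ) : w k ^ 2 / (P k k + l k) ≤ precVar P w l := by
  set x := (P + Matrix.diagonal l)⁻¹ *ᵥ w with hx
  have hkk : 0 < P k k + l k := add_pos_of_pos_of_nonneg hP.diag_pos (hl k)
  set s := w k / (P k k + l k) with hs
  have h1 := dotProduct_mulVec_self_nonneg (posDef_add_diagonal hP hl) (x - Pi.single k s)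
  have hAx : (P + Matrix.diagonal l) *ᵥ x = w := add_diagonal_mulVec_inv_mulVec hP hl w
  have hAk : ((P + Matrix.diagonal l) *ᵥ Pi.single k s) k = (P k k + l k) * s := by
    simp [add_mul]
  have hxk : x ⬝ᵥ (P + Matrix.diagonal l) *ᵥ Pi.single k s = s * w k := by
    rw [dotProduct_mulVec_comm hP hl, hAx, single_dotProduct]
  rw [Matrix.mulVec_sub, hAx, sub_dotProduct, dotProduct_sub, dotProduct_sub, hxk,
    single_dotProduct, single_dotProduct, hAk] at h1
  have e : w k ^ 2 / (P k k + l k) = s * w k := by rw [hs]; ring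
  have e2 : (P k k + l k) * s = w k := by rw [hs]; field_simp
  rw [e2] at h1
  rw [e, precVar, ← hx, dotProduct_comm]; linarith

/-- Prior information only helps: the bound is the variance under a flat prior. It follows by
completing the square in each coordinate. -/
lemma precVar_le_sum (hP : P.PosDef) (hl : ∀ k, 0 < l k) : precVar P w l ≤ ∑ k, w k ^ 2 / l k := by
  have hl' : ∀ k, 0 ≤ l k := fun k => (hl k).le
  set x := (P + Matrix.diagonal l)⁻¹ *ᵥ w with hx
  have h1 := dotProduct_add_diagonal_mulVec (P := P) (l := l) x
  rw [add_diagonal_mulVec_inv_mulVec hP hl', dotProduct_comm] at h1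
  have h2 := dotProduct_mulVec_self_nonneg hP x
  have h3 : 2 * (w ⬝ᵥ x) - ∑ k, l k * x k ^ 2 ≤ ∑ k, w k ^ 2 / l k := by
    rw [dotProduct, Finset.mul_sum, ← Finset.sum_sub_distrib]
    refine Finset.sum_le_sum fun k _ => ?_
    rw [le_div_iff₀ (hl k)]
    nlinarith [sq_nonneg (w k - l k * x k)]
  rw [precVar, ← hx]; linarith

lemma inv_apply_self_nonneg (hP : P.PosDef) (hl : ∀ k, 0 ≤ l k) (k : κ) : 0 ≤ (P + Matrix.diagonal l)⁻¹ k k :=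
  (posDef_add_diagonal hP hl).inv.diag_pos.le

lemma inv_apply_self_le (hP : P.PosDef) (hl : ∀ k, 0 ≤ l k) {k : κ} (hk : 0 < l k) : (P + Matrix.diagonal l)⁻¹ k k ≤ 1 / l k := by
  have h1 := sum_mul_sq_le_precVar hP hl (w := Pi.single k 1)
  have h2 : l k * (P + Matrix.diagonal l)⁻¹ k k ^ 2 ≤ (P + Matrix.diagonal l)⁻¹ k k := by
    refine le_trans ?_ (h1.trans_eq ?_)
    · have := Finset.single_le_sum (f := fun j => l j *
        ((P + Matrix.diagonal l)⁻¹ *ᵥ Pi.single k 1) j ^ 2)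
        (fun j _ => mul_nonneg (hl j) (sq_nonneg _)) (Finset.mem_univ k)
      simpa using this
    · simp [precVar]
  have h3 := inv_apply_self_nonneg hP hl k
  rw [le_div_iff₀ hk]
  by_contra h
  push Not at h
  have h4 : 0 < (P + Matrix.diagonal l)⁻¹ k k := by
    rcases h3.lt_or_eq with h4 | h4
    · exact h4
    · rw [← h4] at h; linarith
  nlinarith

/-- The reduction of the variance through one more observation. -/
lemma precVar_add_single (hP : P.PosDef) (hl : ∀ k, 0 ≤ l k) (k : κ) {s : ℝ} (hs : 0 < s) :
    precVar P w (l + Pi.single k (1 / s)) = precVar P w l -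
      ((P + Matrix.diagonal l)⁻¹ *ᵥ w) k ^ 2 / (s + (P + Matrix.diagonal l)⁻¹ k k) := by
  set A := P + Matrix.diagonal l with hA
  set x := A⁻¹ *ᵥ w with hx
  set y := A⁻¹ *ᵥ Pi.single k 1 with hy
  have hyk : y k = A⁻¹ k k := by simp [hy]
  have hpos : 0 < s + A⁻¹ k k := add_pos_of_pos_of_nonneg hs (inv_apply_self_nonneg hP hl k)
  set c := x k / (s + A⁻¹ k k) with hc
  have hl' : ∀ j, 0 ≤ (l + Pi.single k (1 / s) : κ → ℝ) j := fun j => by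
    have : 0 ≤ (Pi.single k (1 / s) : κ → ℝ) j := by
      by_cases h : j = k
      · subst h; simp [hs.le]
      · simp [h]
    exact add_nonneg (hl j) this
  have hAx : A *ᵥ x = w := add_diagonal_mulVec_inv_mulVec hP hl w
  have hAy : A *ᵥ y = Pi.single k 1 := add_diagonal_mulVec_inv_mulVec hP hl _
  -- Sherman–Morrison for a rank-one update, verified by applying the updated matrix to the
  -- candidate solution.
  have hinv : (P + Matrix.diagonal (l + Pi.single k (1 / s)))⁻¹ *ᵥ w = x - c • y := by
    refine inv_mulVec_eq hP hl' ?_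
    have e : P + Matrix.diagonal (l + Pi.single k (1 / s)) =
        A + Matrix.diagonal (Pi.single k (1 / s)) := by
      rw [hA, add_assoc, Matrix.diagonal_add]; rfl
    rw [e, Matrix.add_mulVec, Matrix.mulVec_sub, hAx, Matrix.mulVec_smul, hAy]
    ext j
    simp only [Pi.add_apply, Pi.sub_apply, Pi.smul_apply, Matrix.mulVec_diagonal, smul_eq_mul]
    by_cases h : j = k
    · subst h
      simp only [Pi.single_eq_same, hyk, hc]
      field_simp
      ring
    · simp [h]
  have hwy : w ⬝ᵥ y = x k := by
    rw [← hAx, dotProduct_comm, dotProduct_mulVec_comm hP hl, hAy, dotProduct_single, mul_one]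
  rw [precVar, hinv, dotProduct_sub, dotProduct_smul, hwy, precVar, hc, smul_eq_mul]
  ring

end PosteriorVariance

/-! ### Optimal allocations of a given number of observations -/

section Allocation

lemma exists_pos_forall_le {κ : Type*} [Finite κ] (h : κ → ℝ) : ∃ M > 0, ∀ k, h k ≤ M := by
  have := Fintype.ofFinite κ
  refine ⟨∑ k, |h k| + 1, by positivity, fun k => ?_⟩
  have := Finset.single_le_sum (f := fun k => |h k|) (fun _ _ => abs_nonneg _) (Finset.mem_univ k)
  have := le_abs_self (h k)
  linarith

lemma exists_pos_le_forall {κ : Type*} [Finite κ] [Nonempty κ] (h : κ → ℝ)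
    (hpos : ∀ k, 0 < h k) : ∃ c > 0, ∀ k, c ≤ h k := by
  obtain ⟨k, hk⟩ := Finite.exists_min h
  exact ⟨h k, hpos k, hk⟩

variable {κ : Type*} [Fintype κ] [DecidableEq κ]

/-- The variance of `⟨w, η⟩` after `q k` observations of each coordinate `η k` with noise variance
`s k`, when the prior precision of `η` is `P`. -/
noncomputable def allocVar (P : Matrix κ κ ℝ) (w s : κ → ℝ) (q : κ → ℕ) : ℝ :=
  precVar P w fun k => q k / s k

/-- `q` minimizes the posterior variance among all allocations of `n` observations. -/
def IsMinAlloc (P : Matrix κ κ ℝ) (w s : κ → ℝ) (n : ℕ) (q : κ → ℕ) : Prop :=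
  ∑ k, q k = n ∧ ∀ q' : κ → ℕ, ∑ k, q' k = n → allocVar P w s q ≤ allocVar P w s q'

lemma exists_isMinAlloc [Nonempty κ] (P : Matrix κ κ ℝ) (w s : κ → ℝ) (n : ℕ) :
    ∃ q, IsMinAlloc P w s n q := by
  have hne : (Finset.piAntidiag (Finset.univ : Finset κ) n).Nonempty := by
    obtain ⟨k⟩ := ‹Nonempty κ›
    exact ⟨Pi.single k n, by simp [Finset.mem_piAntidiag]⟩
  obtain ⟨q, hq, hmin⟩ := Finset.exists_min_image _ (allocVar P w s) hne
  refine ⟨q, (Finset.mem_piAntidiag.1 hq).1, fun q' hq' => hmin q' ?_⟩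
  exact Finset.mem_piAntidiag.2 ⟨hq', fun _ _ => Finset.mem_univ _⟩

variable {P : Matrix κ κ ℝ} {w s : κ → ℝ}

/-- An even split, with the remainder given to one source, gives every source at least n / (2N)
observations. This is the O(1/n) benchmark that an optimal allocation has to match. -/
lemma exists_allocVar_le [Nonempty κ] (hP : P.PosDef) (hs : ∀ k, 0 < s k) {n : ℕ}
    (hn : Fintype.card κ ≤ n) :
    ∃ q : κ → ℕ, ∑ k, q k = n ∧
      allocVar P w s q ≤ (∑ k, w k ^ 2 * s k) * (2 * Fintype.card κ) / n := by
  obtain ⟨k₀⟩ := ‹Nonempty κ›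
  have hcard : 0 < Fintype.card κ := Fintype.card_pos_iff.2 ⟨k₀⟩
  set N := Fintype.card κ with hN
  have hn0 : (0 : ℝ) < n := by exact_mod_cast lt_of_lt_of_le hcard hn
  set q : κ → ℕ := fun k => n / N + if k = k₀ then n % N else 0 with hq
  have hdiv : (n : ℝ) ≤ 2 * N * ((n / N : ℕ) : ℝ) := by
    have h1 : 1 ≤ n / N := (Nat.one_le_div_iff hcard).2 hn
    have h2 : n < N * (n / N + 1) := Nat.lt_mul_div_succ n hcard
    have h3 : N * (n / N + 1) ≤ 2 * N * (n / N) := by nlinarith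
    exact_mod_cast h2.le.trans h3
  have hqk : ∀ k, (n : ℝ) ≤ 2 * N * q k := fun k => by
    refine hdiv.trans ?_
    have : ((n / N : ℕ) : ℝ) ≤ q k := by exact_mod_cast Nat.le_add_right _ _
    gcongr
  have hqpos : ∀ k, (0 : ℝ) < q k := fun k => by
    have := hqk k
    by_contra h
    have h0 : (q k : ℝ) = 0 := le_antisymm (not_lt.1 h) (Nat.cast_nonneg _)
    rw [h0] at this; linarith
  refine ⟨q, ?_, (precVar_le_sum hP fun k => div_pos (hqpos k) (hs k)).trans ?_⟩
  · simp only [hq, Finset.sum_add_distrib, Finset.sum_const, Finset.card_univ, ← hN, smul_eq_mul,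
      Finset.sum_ite_eq', Finset.mem_univ, if_true]
    exact Nat.div_add_mod n N
  · rw [Finset.sum_mul, Finset.sum_div]
    refine Finset.sum_le_sum fun k _ => ?_
    have := hqk k
    have := hqpos k
    have := hs k
    rw [div_div_eq_mul_div, div_le_div_iff₀ (hqpos k) hn0]
    nlinarith [mul_nonneg (sq_nonneg (w k)) (hs k).le]

/-- By `sq_div_le_precVar`, a source with few observations would push the variance above the O(1/n)
benchmark; here w k ≠ 0 is essential. The bound is stated for q k - 1 because the exchange argument
removes one observation. -/
lemma exists_linear_lower_bound [Nonempty κ] (hP : P.PosDef) (hw : ∀ k, w k ≠ 0)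
    (hs : ∀ k, 0 < s k) :
    ∃ c > 0, ∃ n₀ : ℕ, ∀ n ≥ n₀, ∀ q, IsMinAlloc P w s n q → ∀ k, c * n ≤ ((q k : ℝ) - 1) / s k := by
  set a := (∑ k, w k ^ 2 * s k) * (2 * Fintype.card κ) with ha
  have ha0 : 0 < a := by
    have : 0 < ∑ k, w k ^ 2 * s k := Finset.sum_pos
      (fun k _ => mul_pos (by have := hw k; positivity) (hs k)) Finset.univ_nonempty
    have : (0 : ℝ) < Fintype.card κ := by exact_mod_cast Fintype.card_pos
    positivity
  -- The factor 2 leaves a surplus c * n, which absorbs P k k + 1 / s k ≤ d as soon as n ≥ d / c.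
  obtain ⟨c, hc, hcw⟩ := exists_pos_le_forall (fun k => w k ^ 2 / (2 * a))
    fun k => by have := hw k; positivity
  obtain ⟨d, hd, hdP⟩ := exists_pos_forall_le fun k => P k k + 1 / s k
  refine ⟨c, hc, max (Fintype.card κ) ⌈d / c⌉₊, fun n hn q hq k => ?_⟩
  have hnN : Fintype.card κ ≤ n := (le_max_left _ _).trans hn
  have hn0 : (0 : ℝ) < n := by exact_mod_cast lt_of_lt_of_le Fintype.card_pos hnN
  have hnd : d ≤ c * n := by
    have : d / c ≤ n := (Nat.le_ceil _).trans (by exact_mod_cast (le_max_right _ _).trans hn)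
    rwa [div_le_iff₀ hc, mul_comm] at this
  obtain ⟨q', hq', hle⟩ := exists_allocVar_le (w := w) hP hs hnN
  have h1 := (sq_div_le_precVar hP (w := w) (l := fun k => (q k : ℝ) / s k)
    (fun k => div_nonneg (Nat.cast_nonneg _) (hs k).le) k).trans ((hq.2 q' hq').trans hle)
  have hkk : 0 < P k k + q k / s k :=
    add_pos_of_pos_of_nonneg hP.diag_pos (div_nonneg (Nat.cast_nonneg _) (hs k).le)
  rw [← ha, div_le_div_iff₀ hkk hn0] at h1
  have h2 := hcw k
  rw [le_div_iff₀ (by positivity)] at h2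
  have h3 := hdP k
  have h4 : c * 2 * n ≤ P k k + q k / s k := by
    have : a * (c * 2 * n) ≤ a * (P k k + q k / s k) := by nlinarith
    exact le_of_mul_le_mul_left this ha0
  rw [sub_div]
  linarith

/-- Up to a bounded error, optimal allocations are proportional to `√(s k) * |w k|`. -/
lemma exists_pairwise_bound [Nonempty κ] (hP : P.PosDef) (hw : ∀ k, w k ≠ 0)
    (hs : ∀ k, 0 < s k) :
    ∃ D > 0, ∃ n₀ : ℕ, ∀ n ≥ n₀, ∀ q, IsMinAlloc P w s n q → ∀ i j,
      √(s i) * |w i| * q j ≤ √(s j) * |w j| * q i + D := by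
  obtain ⟨c, hc, n₀, hlow⟩ := exists_linear_lower_bound hP hw hs
  set W := ∑ k, w k ^ 2 with hW
  have hW0 : 0 ≤ W := Finset.sum_nonneg fun k _ => sq_nonneg _
  obtain ⟨b, hb, hbP⟩ := exists_pos_forall_le fun k => ∑ l, |P k l|
  set p := b * (√W / c) with hp
  have hp0 : 0 ≤ p := by positivity
  obtain ⟨e, he, hes⟩ := exists_pos_forall_le fun k => 1 / (c * s k)
  obtain ⟨τ, hτ, hτs⟩ := exists_pos_forall_le fun k => √(s k)
  obtain ⟨g, hg, hgs⟩ := exists_pos_forall_le fun k => √(s k) * |w k|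
  -- The four summands bound the errors in `h4`, `h3`, `h2` and `h5` at the end.
  refine ⟨p * τ + p * τ * (1 + e) + g * e + g, by positivity, max n₀ 1, fun n hn q hq i j => ?_⟩
  have hD : 0 ≤ p * τ + p * τ * (1 + e) + g * e + g := by positivity
  rcases eq_or_ne i j with rfl | hij
  · linarith
  have hn1 : (1 : ℝ) ≤ n := by exact_mod_cast (le_max_right _ _).trans hn
  have hn0 : (0 : ℝ) < n := by linarith
  have hcn : 0 < c * n := by positivity
  have hlow := hlow n ((le_max_left _ _).trans hn) q hq
  have hq1 : ∀ k, 1 ≤ q k := fun k => by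
    have h1 := hcn.trans_le (hlow k)
    rw [lt_div_iff₀ (hs k), zero_mul] at h1
    have : (1 : ℝ) < q k := by linarith
    exact_mod_cast this.le
  -- Exchange argument: remove one observation of source j from the optimum. Putting it back must
  -- lower the variance at least as much as giving it to source i would, and both reductions are
  -- computed at the same base r.
  set r : κ → ℕ := q - Pi.single j 1 with hr
  have hrq : r + Pi.single j 1 = q := by
    ext k
    by_cases h : k = j
    · subst h; have := hq1 k; simp [hr]; omega
    · simp [hr, h]
  have hrsum : ∑ k, r k + 1 = n := by
    rw [← hq.1, ← hrq]
    simp [Finset.sum_add_distrib]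
  have hrn : ∀ k, (r k : ℝ) ≤ n := fun k => by
    have := Finset.single_le_sum (f := r) (fun _ _ => Nat.zero_le _) (Finset.mem_univ k)
    exact_mod_cast by omega
  set l : κ → ℝ := fun k => r k / s k with hl
  have hcl : ∀ k, c * n ≤ l k := fun k => by
    refine (hlow k).trans ?_
    have : (q k : ℝ) - 1 ≤ r k := by
      have h1 : q k ≤ r k + 1 := by
        by_cases h : k = j
        · subst h; simp [hr]; omega
        · simp [hr, h]
      have : (q k : ℝ) ≤ r k + 1 := by exact_mod_cast h1
      linarith
    exact div_le_div_of_nonneg_right this (hs k).le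
  have hl0 : ∀ k, 0 < l k := fun k => hcn.trans_le (hcl k)
  have hl0' : ∀ k, 0 ≤ l k := fun k => (hl0 k).le
  set x := (P + Matrix.diagonal l)⁻¹ *ᵥ w with hx
  set y : κ → ℝ := fun k => (P + Matrix.diagonal l)⁻¹ k k with hy
  have hy0 : ∀ k, 0 ≤ y k := fun k => inv_apply_self_nonneg hP hl0' k
  have hyle : ∀ k, y k ≤ 1 / (c * n) := fun k =>
    (inv_apply_self_le hP hl0' (hl0 k)).trans (one_div_le_one_div_of_le hcn (hcl k))
  have hupd : ∀ k, allocVar P w s (r + Pi.single k 1) =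
      precVar P w l - x k ^ 2 / (s k + y k) := fun k => by
    rw [← precVar_add_single hP hl0' k (hs k), allocVar]
    congr 1
    ext k'
    by_cases h : k' = k
    · subst h; simp [hl, add_div]
    · simp [hl, h]
  have hexch : x i ^ 2 / (s i + y i) ≤ x j ^ 2 / (s j + y j) := by
    have h1 := hq.2 (r + Pi.single i 1) (by
      simp only [Pi.add_apply, Finset.sum_add_distrib, Finset.sum_pi_single', Finset.mem_univ,
        if_true]
      exact hrsum)
    rw [← hrq, hupd, hupd] at h1
    linarith
  -- All precisions are at least c * n, so the two bounds on `precVar` squeeze x to order 1 / n.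
  have hxk : ∀ k, |x k| ≤ √W / c / n := fun k => by
    have h1 : c * n * x k ^ 2 ≤ W / (c * n) := by
      calc c * n * x k ^ 2 ≤ l k * x k ^ 2 := by gcongr; exact hcl k
        _ ≤ ∑ k, l k * x k ^ 2 := Finset.single_le_sum (f := fun k => l k * x k ^ 2)
            (fun k _ => mul_nonneg (hl0' k) (sq_nonneg _)) (Finset.mem_univ k)
        _ ≤ precVar P w l := sum_mul_sq_le_precVar hP hl0'
        _ ≤ ∑ k, w k ^ 2 / l k := precVar_le_sum hP hl0
        _ ≤ ∑ k, w k ^ 2 / (c * n) := by gcongr with k _; exact hcl k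
        _ = W / (c * n) := by rw [hW, Finset.sum_div]
    refine abs_le_of_sq_le_sq ?_ (by positivity) 
    rw [div_pow, div_pow, Real.sq_sqrt hW0, div_div, ← mul_pow, le_div_iff₀ (by positivity)]
    rw [le_div_iff₀ hcn] at h1
    nlinarith
  have hPx : ∀ k, |(P *ᵥ x) k| ≤ p / n := fun k => by
    calc |(P *ᵥ x) k| ≤ ∑ l, |P k l| * |x l| := by
          rw [Matrix.mulVec, dotProduct]
          refine (Finset.abs_sum_le_sum_abs _ _).trans_eq ?_
          simp only [abs_mul]
      _ ≤ ∑ l, |P k l| * (√W / c / n) := by gcongr with l _; exact hxk l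
      _ = (∑ l, |P k l|) * (√W / c / n) := by rw [Finset.sum_mul]
      _ ≤ b * (√W / c / n) := by gcongr; exact hbP k
      _ = p / n := by rw [hp]; ring
  -- Row k of (P + diag l) x = w. As P x = O(1 / n), the product l k * x k equals w k up to O(1 /
  -- n).
  have hlx : ∀ k, l k * x k = w k - (P *ᵥ x) k := fun k => by
    have := congrFun (add_diagonal_mulVec_inv_mulVec hP hl0' w) k
    rw [add_diagonal_mulVec_apply] at this
    linarith
  have hα1 : ∀ k, |l k * x k| ≤ |w k| + p / n := fun k => by
    rw [hlx]; exact (abs_sub _ _).trans (by linarith [hPx k])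
  have hα2 : ∀ k, |w k| - p / n ≤ |l k * x k| := fun k => by
    rw [hlx]; exact le_trans (by linarith [hPx k]) (abs_sub_abs_le_abs_sub _ _)
  -- Square root of the exchange inequality, with y = O(1 / n) absorbed into the factor 1 + e / n.
  have hx2 : |x i| * √(s j) ≤ |x j| * (√(s i) * (1 + e / n)) := by
    refine abs_le_of_sq_le_sq' ?_ (by positivity) |>.2
    rw [mul_pow, mul_pow, mul_pow, sq_abs, sq_abs, Real.sq_sqrt (hs i).le, Real.sq_sqrt (hs j).le]
    rw [div_le_div_iff₀ (add_pos_of_pos_of_nonneg (hs i) (hy0 i))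
      (add_pos_of_pos_of_nonneg (hs j) (hy0 j))] at hexch
    have h1 : y i ≤ s i * (e / n) := by
      refine (hyle i).trans ?_
      have := hes i
      rw [div_le_iff₀ (mul_pos hc (hs i))] at this
      rw [div_le_iff₀ hcn]
      field_simp
      linarith
    have h2 : s i + y i ≤ s i * (1 + e / n) ^ 2 := by
      have : 0 ≤ e / n := by positivity
      nlinarith [mul_nonneg (hs i).le this, mul_nonneg (hs i).le (sq_nonneg (e / n))]
    calc x i ^ 2 * s j ≤ x i ^ 2 * (s j + y j) := by gcongr; linarith [hy0 j]
      _ ≤ x j ^ 2 * (s i + y i) := hexch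
      _ ≤ _ := by gcongr
  have hsq : ∀ k, s k = √(s k) * √(s k) := fun k => (Real.mul_self_sqrt (hs k).le).symm
  have hrl : ∀ k, (r k : ℝ) = l k * s k := fun k => by
    rw [hl]; have := (hs k).ne'; field_simp
  -- Multiplying by the precisions replaces each x k by l k * x k, which is close to w k, and brings
  -- in the counts r k.
  have hmain : |l i * x i| * √(s i) * r j ≤ |l j * x j| * √(s j) * r i * (1 + e / n) := by
    rw [hrl i, hrl j, abs_mul, abs_mul, abs_of_pos (hl0 i), abs_of_pos (hl0 j)]
    have e1 : l i * |x i| * √(s i) * (l j * s j) =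
        l i * l j * √(s i) * √(s j) * (|x i| * √(s j)) := by
      linear_combination (l i * |x i| * √(s i) * l j) * hsq j
    have e2 : l j * |x j| * √(s j) * (l i * s i) * (1 + e / n) =
        l i * l j * √(s i) * √(s j) * (|x j| * (√(s i) * (1 + e / n))) := by
      linear_combination (l j * |x j| * √(s j) * l i * (1 + e / n)) * hsq i
    have h0 : 0 ≤ l i * l j * √(s i) * √(s j) := by have := hl0' i; have := hl0' j; positivity
    rw [e1, e2]
    exact mul_le_mul_of_nonneg_left hx2 h0
  have h1 : (|w i| - p / n) * √(s i) * r j ≤ (|w j| + p / n) * √(s j) * r i * (1 + e / n) := by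
    refine le_trans ?_ (hmain.trans ?_)
    · gcongr; exact hα2 i
    · gcongr; exact hα1 j
  have hpr : ∀ k k', p / n * √(s k) * r k' ≤ p * τ := fun k k' => by
    calc p / n * √(s k) * r k' ≤ p / n * τ * n := by gcongr; exacts [hτs k, by exact_mod_cast hrn k']
      _ = p * τ := by field_simp
  have hen : e / n ≤ e := div_le_self he.le hn1
  have h2 : √(s j) * |w j| * r i * (e / n) ≤ g * e := by
    calc √(s j) * |w j| * r i * (e / n) ≤ g * n * (e / n) := by
          gcongr; exacts [hgs j, by exact_mod_cast hrn i]
      _ = g * e := by field_simp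
  have h3 : p / n * √(s j) * r i * (1 + e / n) ≤ p * τ * (1 + e) := by
    exact mul_le_mul (hpr j i) (by linarith) (by positivity) (by positivity)
  have h4 := hpr i j
  have hri : (r i : ℝ) = q i := by simp [hr, hij]
  have hrj : (q j : ℝ) = r j + 1 := by
    have := hq1 j
    have : q j = r j + 1 := by simp [hr]; omega
    exact_mod_cast this
  have h5 := hgs i
  rw [hrj, ← hri]
  nlinarith

/-- Sum the pairwise bound over j and use ∑ q j = n. The extra g * n₀ makes the constant valid for
small n as well. -/
lemma exists_proportional_bound [Nonempty κ] (hP : P.PosDef) (hw : ∀ k, w k ≠ 0)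
    (hs : ∀ k, 0 < s k) :
    ∃ R > 0, ∀ n q, IsMinAlloc P w s n q → ∀ i,
      √(s i) * |w i| * n ≤ (∑ k, √(s k) * |w k|) * q i + R := by
  obtain ⟨D, hD, n₀, h⟩ := exists_pairwise_bound hP hw hs
  obtain ⟨g, hg, hgs⟩ := exists_pos_forall_le fun k => √(s k) * |w k|
  refine ⟨Fintype.card κ * D + g * n₀, ?_, fun n q hq i => ?_⟩
  · have : (0 : ℝ) < Fintype.card κ := by exact_mod_cast Fintype.card_pos
    positivity
  have hG : 0 ≤ ∑ k, √(s k) * |w k| := Finset.sum_nonneg fun k _ => by positivity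
  rcases lt_or_ge n n₀ with hn | hn
  · have h1 : √(s i) * |w i| * n ≤ g * n₀ := by
      gcongr; exact hgs i
    have : 0 ≤ (∑ k, √(s k) * |w k|) * q i := by positivity
    have : 0 ≤ Fintype.card κ * D := by positivity
    linarith
  · have h1 := Finset.sum_le_sum fun j (_ : j ∈ Finset.univ) => h n hn q hq i j
    rw [← Finset.mul_sum, Finset.sum_add_distrib, ← Finset.sum_mul, Finset.sum_const,
      Finset.card_univ, nsmul_eq_mul, ← Nat.cast_sum, hq.1] at h1
    have : 0 ≤ g * n₀ := by positivity
    linarith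

/-- For a large block size, optimal allocations of successive multiples of the block size
are ordered. -/
lemma exists_monotone_isMinAlloc [Nonempty κ] (hP : P.PosDef) (hw : ∀ k, w k ≠ 0)
    (hs : ∀ k, 0 < s k) :
    ∃ B₀ : ℕ, ∀ B ≥ B₀, ∃ N : ℕ → κ → ℕ, Monotone N ∧ ∀ t, IsMinAlloc P w s (B * t) (N t) := by
  obtain ⟨R, hR, h⟩ := exists_proportional_bound hP hw hs
  obtain ⟨c, hc, hcg⟩ := exists_pos_le_forall (fun k => √(s k) * |w k|)
    fun k => mul_pos (Real.sqrt_pos.2 (hs k)) (abs_pos.2 (hw k))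
  -- The lower bound at t + 1 loses R and the upper bound at t loses card κ * R; the growth √(s i) *
  -- |w i| * B ≥ c * B has to cover both.
  refine ⟨⌈(Fintype.card κ + 1) * R / c⌉₊, fun B hB => ?_⟩
  choose N hN using fun t => exists_isMinAlloc P w s (B * t)
  refine ⟨N, monotone_nat_of_le_succ fun t i => ?_, hN⟩
  set G := ∑ k, √(s k) * |w k| with hG
  have hG0 : 0 < G := Finset.sum_pos
    (fun k _ => mul_pos (Real.sqrt_pos.2 (hs k)) (abs_pos.2 (hw k))) Finset.univ_nonempty
  have hB' : (Fintype.card κ + 1) * R ≤ √(s i) * |w i| * B := by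
    have h1 : (Fintype.card κ + 1) * R / c ≤ B := (Nat.le_ceil _).trans (by exact_mod_cast hB)
    rw [div_le_iff₀ hc] at h1
    have := mul_le_mul_of_nonneg_left (hcg i) (Nat.cast_nonneg (α := ℝ) B)
    linarith
  have h1 := h _ _ (hN (t + 1)) i
  -- The total is fixed, so lower bounds for all other sources give an upper bound for source i.
  have h2 : G * N t i ≤ √(s i) * |w i| * (B * t : ℕ) + Fintype.card κ * R := by
    have h3 := Finset.sum_le_sum fun j (_ : j ∈ Finset.univ.erase i) => h _ _ (hN t) j
    rw [← Finset.sum_mul, Finset.sum_add_distrib, ← Finset.mul_sum, Finset.sum_const,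
      Finset.card_erase_of_mem (Finset.mem_univ i), Finset.card_univ, nsmul_eq_mul] at h3
    have e1 : ∑ k ∈ Finset.univ.erase i, √(s k) * |w k| = G - √(s i) * |w i| := by
      rw [hG, ← Finset.add_sum_erase _ _ (Finset.mem_univ i)]; ring
    have e2 : ∑ k ∈ Finset.univ.erase i, (N t k : ℝ) = (B * t : ℕ) - N t i := by
      rw [← (hN t).1, Nat.cast_sum, ← Finset.add_sum_erase _ _ (Finset.mem_univ i)]; ring
    rw [e1, e2] at h3
    have e3 : ((Fintype.card κ - 1 : ℕ) : ℝ) * R ≤ Fintype.card κ * R := by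
      gcongr; exact Nat.sub_le _ _
    linarith
  have h3 : G * N t i ≤ G * N (t + 1) i := by
    push_cast at h1 h2
    linarith
  exact_mod_cast le_of_mul_le_mul_left h3 hG0

end Allocation

/-! ### Reproducing a Gram matrix one vector at a time -/

section GramExtension

variable {H₁ H₂ : Type*} [NormedAddCommGroup H₁] [InnerProductSpace ℝ H₁]
  [NormedAddCommGroup H₂] [InnerProductSpace ℝ H₂]

/-- Solvability of a finite moment problem with a norm bound. -/
lemma exists_mem_span_inner_eq {ι : Type*} [Fintype ι] (f : ι → H₂) (c : ι → ℝ) {M : ℝ} (hM : 0 ≤ M)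
    (h : ∀ a : ι → ℝ, |∑ i, a i * c i| ≤ M * ‖∑ i, a i • f i‖) :
    ∃ y ∈ Submodule.span ℝ (Set.range f), (∀ i, inner ℝ y (f i) = c i) ∧ ‖y‖ ≤ M := by
  classical
  set A : (ι → ℝ) →ₗ[ℝ] H₂ := Fintype.linearCombination ℝ f with hA
  have hAa : ∀ a, A a = ∑ i, a i • f i := fun a => by
    simp [hA, Fintype.linearCombination_apply]
  set ℓ : (ι → ℝ) →ₗ[ℝ] ℝ := Fintype.linearCombination ℝ c with hℓ
  have hℓa : ∀ a, ℓ a = ∑ i, a i * c i := fun a => by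
    simp [hℓ, Fintype.linearCombination_apply]
  have hbound : ∀ a, |ℓ a| ≤ M * ‖A a‖ := fun a => by rw [hℓa, hAa]; exact h a
  obtain ⟨g, hg⟩ := A.rangeRestrict.exists_rightInverse_of_surjective
    (LinearMap.range_eq_top.2 A.surjective_rangeRestrict)
  have hg' : ∀ v : LinearMap.range A, A (g v) = v := fun v => by
    have := congrArg (fun φ => ((φ v : LinearMap.range A) : H₂)) hg
    simpa using this
  -- The bound makes ℓ vanish on the kernel of A, so ℓ factors through the range of A, where the
  -- Riesz representative is taken.
  have hfac : ∀ a, ℓ (g (A.rangeRestrict a)) = ℓ a := fun a => by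
    have h0 := hbound (g (A.rangeRestrict a) - a)
    rw [map_sub, map_sub, hg'] at h0
    simp only [LinearMap.codRestrict_apply, LinearMap.rangeRestrict, sub_self, norm_zero, mul_zero] at h0
    exact sub_eq_zero.1 (abs_eq_zero.1 (le_antisymm h0 (abs_nonneg _)))
  set φ : LinearMap.range A →L[ℝ] ℝ := LinearMap.toContinuousLinearMap (ℓ ∘ₗ g) with hφ
  set y := (InnerProductSpace.toDual ℝ (LinearMap.range A)).symm φ with hy
  have hin : ∀ v : LinearMap.range A, inner ℝ (y : H₂) v = ℓ (g v) := fun v => by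
    rw [← Submodule.coe_inner, hy, InnerProductSpace.toDual_symm_apply]; rfl
  refine ⟨y, ?_, fun i => ?_, ?_⟩
  · rw [← Fintype.range_linearCombination ℝ f]; exact y.2
  · have h1 : A (Pi.single i 1) = f i := by
      rw [hA, Fintype.linearCombination_apply_single, one_smul]
    have h2 := hin (A.rangeRestrict (Pi.single i 1))
    rw [hfac, LinearMap.codRestrict_apply, h1, hℓ, Fintype.linearCombination_apply_single] at h2
    simpa using h2
  · have h1 := hin y
    have h2 := hbound (g y)
    rw [hg', ← h1, real_inner_self_eq_norm_sq, abs_of_nonneg (sq_nonneg _), sq] at h2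
    by_cases h0 : ‖(y : H₂)‖ = 0
    · exact h0.trans_le hM
    · exact le_of_mul_le_mul_right h2 (lt_of_le_of_ne (norm_nonneg _) (Ne.symm h0))


/-- If `y` reproduces the Gram matrix of `x` together with `u₁`, `u₂`, and `x'` carries no more
information about `u₁` on top of `x` than `m` does about `u₂`, then the Gram matrix of `x` and `x'`
can be reproduced with a vector built from `y`, `m` and a fresh unit vector `z`. -/
lemma exists_gram_extension {ι : Type*} [Finite ι] {x : ι → H₁} {y : ι → H₂} {u₁ : H₁} {u₂ : H₂}
    (hxy : ∀ i j, inner ℝ (x i) (x j) = inner ℝ (y i) (y j))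
    (hux : ∀ i, inner ℝ u₁ (x i) = inner ℝ u₂ (y i)) (hu : ‖u₁‖ = ‖u₂‖)
    {m z : H₂} (hmy : ∀ i, inner ℝ (u₂ - m) (y i) = 0) (hmm : inner ℝ (u₂ - m) m = 0)
    (hzy : ∀ i, inner ℝ z (y i) = 0) (hzm : inner ℝ z m = 0) (hzu : inner ℝ z u₂ = 0)
    (hz : ‖z‖ = 1) {x' : H₁}
    (hdist : ∀ v ∈ Submodule.span ℝ (insert x' (Set.range x)), ‖u₂ - m‖ ≤ ‖u₁ - v‖) :
    ∃ y' ∈ Submodule.span ℝ (insert z (insert m (Set.range y))),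
      (∀ i, inner ℝ y' (y i) = inner ℝ x' (x i)) ∧ inner ℝ u₂ y' = inner ℝ u₁ x' ∧
        ‖y'‖ = ‖x'‖ := by
  have := Fintype.ofFinite ι
  -- The part y₀ of the copy in the span of m and y is sought with ⟨y₀, m⟩ = ⟨u₁, x'⟩. This
  -- prescribes ⟨u₂, y₀⟩ as well, because u₂ - m is orthogonal to that span.
  let f : Option ι → H₂ := fun o => o.elim m y
  let c : Option ι → ℝ := fun o => o.elim (inner ℝ u₁ x') fun i => inner ℝ x' (x i)
  have key : ∀ a : Option ι → ℝ, |∑ i, a i * c i| ≤ ‖x'‖ * ‖∑ i, a i • f i‖ := by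
    intro a
    set b := a none with hb
    set p := ∑ i, a (some i) • x i with hp
    set r := ∑ i, a (some i) • y i with hr
    have hc : ∑ i, a i * c i = inner ℝ x' (b • u₁ + p) := by
      simp [Fintype.sum_option, c, inner_add_right, inner_smul_right, hp, inner_sum,
        real_inner_comm, hb]
    have hf : ∑ i, a i • f i = b • m + r := by
      simp [Fintype.sum_option, f, hr, hb]
    have hpr : inner ℝ p p = inner ℝ r r := by
      simp only [hp, hr, inner_sum, sum_inner, inner_smul_left, inner_smul_right, hxy]
    have hur : inner ℝ u₁ p = inner ℝ u₂ r := by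
      simp [hp, hr, inner_sum, inner_smul_right, hux]
    have hmr : inner ℝ (u₂ - m) r = 0 := by
      simp [hr, inner_sum, inner_smul_right, hmy]
    -- Replacing b • u₁ + p by b • m + r loses exactly b² ‖u₂ - m‖². By `hs`, the distance of b • u₁
    -- + p from the line of x' is at least |b| ‖u₂ - m‖, and the discriminant turns this into the
    -- sharpened Cauchy–Schwarz bound `key`.
    have hg : ‖b • u₁ + p‖ ^ 2 = ‖b • m + r‖ ^ 2 + b ^ 2 * ‖u₂ - m‖ ^ 2 := by
      have e1 : ‖b • u₁ + p‖ ^ 2 = ‖b • u₂ + r‖ ^ 2 := by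
        rw [norm_add_sq_real, norm_add_sq_real, norm_smul, norm_smul, hu, inner_smul_left,
          inner_smul_left, hur, ← real_inner_self_eq_norm_sq p, hpr, real_inner_self_eq_norm_sq]
      have e2 : b • u₂ + r = (b • m + r) + b • (u₂ - m) := by rw [smul_sub]; abel
      rw [e1, e2, norm_add_sq_real, norm_smul, mul_pow, Real.norm_eq_abs, sq_abs]
      have : inner ℝ (b • m + r) (b • (u₂ - m)) = 0 := by
        rw [real_inner_comm, inner_smul_left, inner_add_right, inner_smul_right, hmm, hmr]; simp
      rw [this]; ring
    have hs : ∀ s : ℝ, b ^ 2 * ‖u₂ - m‖ ^ 2 ≤ ‖(b • u₁ + p) - s • x'‖ ^ 2 := by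
      intro s
      by_cases hb0 : b = 0
      · rw [hb0]; simp only [ne_eq, OfNat.ofNat_ne_zero, not_false_eq_true, zero_pow, zero_mul]
        positivity
      have hv := hdist (-(b⁻¹) • (p - s • x')) (by
        refine Submodule.smul_mem _ _ (Submodule.sub_mem _ ?_ (Submodule.smul_mem _ _ ?_))
        · exact Submodule.sum_mem _ fun i _ => Submodule.smul_mem _ _
            (Submodule.subset_span (Or.inr ⟨i, rfl⟩))
        · exact Submodule.subset_span (Or.inl rfl))
      have e : (b • u₁ + p) - s • x' = b • (u₁ - -(b⁻¹) • (p - s • x')) := by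
        rw [smul_sub, smul_smul, mul_neg, mul_inv_cancel₀ hb0]; simp; abel
      rw [e, norm_smul, mul_pow, Real.norm_eq_abs, sq_abs]
      gcongr
    have hq : ∀ s : ℝ, 0 ≤ ‖x'‖ ^ 2 * (s * s) + (-2 * inner ℝ x' (b • u₁ + p)) * s
        + ‖b • m + r‖ ^ 2 := by
      intro s
      have h1 := hs s
      rw [norm_sub_sq_real (b • u₁ + p), norm_smul, mul_pow, Real.norm_eq_abs, sq_abs,
        inner_smul_right, real_inner_comm, hg] at h1
      linarith
    have hd := discrim_le_zero hq
    rw [discrim] at hd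
    rw [hc, hf]
    refine abs_le_of_sq_le_sq ?_ (by positivity)
    rw [mul_pow]; linarith
  obtain ⟨y₀, hy₀, hin, hle⟩ := exists_mem_span_inner_eq f c (norm_nonneg x') key
  have hspan : Submodule.span ℝ (Set.range f) ≤ Submodule.span ℝ (insert m (Set.range y)) := by
    refine Submodule.span_mono ?_
    rintro _ ⟨o, rfl⟩
    cases o with
    | none => exact Or.inl rfl
    | some i => exact Or.inr ⟨i, rfl⟩
  have horth : ∀ (a : H₂), inner ℝ a m = 0 → (∀ i, inner ℝ a (y i) = 0) → inner ℝ a y₀ = 0 := by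
    intro a ham hay
    have : Submodule.span ℝ (insert m (Set.range y)) ≤ LinearMap.ker (innerₛₗ ℝ a) := by
      rw [Submodule.span_le]
      rintro v (rfl | ⟨i, rfl⟩)
      · simpa using ham
      · simpa using hay i
    simpa using this (hspan hy₀)
  have hzy₀ := horth z hzm hzy
  have huy₀ := horth _ hmm hmy
  have hγ : 0 ≤ ‖x'‖ ^ 2 - ‖y₀‖ ^ 2 := by
    have := pow_le_pow_left₀ (norm_nonneg _) hle 2
    linarith
  -- The direction z is orthogonal to everything in play, so it supplies the missing norm without
  -- changing any prescribed inner product.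
  refine ⟨y₀ + √(‖x'‖ ^ 2 - ‖y₀‖ ^ 2) • z, ?_, fun i => ?_, ?_, ?_⟩
  · refine Submodule.add_mem _ ?_ (Submodule.smul_mem _ _ (Submodule.subset_span (Or.inl rfl)))
    exact Submodule.span_mono (Set.subset_insert _ _) (hspan hy₀)
  · rw [inner_add_left, inner_smul_left, hzy, mul_zero, add_zero]
    exact hin (some i)
  · rw [inner_add_right, inner_smul_right, real_inner_comm z u₂, hzu, mul_zero, add_zero]
    rw [inner_sub_left, sub_eq_zero] at huy₀
    rw [huy₀, real_inner_comm]
    exact hin none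
  · rw [← sq_eq_sq₀ (norm_nonneg _) (norm_nonneg _), norm_add_sq_real, inner_smul_right,
      real_inner_comm, hzy₀, norm_smul, hz, mul_one, Real.norm_eq_abs, sq_abs, Real.sq_sqrt hγ]
    ring

variable (u₁ : H₁) (u₂ : H₂) (m z : ℕ → H₂)

/-- A vector that extends the reproduction `y` of `x 0, …, x (n - 1)` by a copy of `x n`. -/
def IsCopy (x : ℕ → H₁) (n : ℕ) (y : Fin n → H₂) (v : H₂) : Prop :=
  v ∈ Submodule.span ℝ (insert (z n) (insert (m n) (Set.range y))) ∧
    (∀ i, inner ℝ v (y i) = inner ℝ (x n) (x i)) ∧ inner ℝ u₂ v = inner ℝ u₁ (x n) ∧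
      ‖v‖ = ‖x n‖

open Classical in
/-- Successive reproduction of the sequence `x` by means of the vectors `m` and `z`. -/
noncomputable def simulate (x : ℕ → H₁) (n : ℕ) : H₂ :=
  -- The default 0 is never used under the hypotheses of `isCopy_simulate`.
  if h : ∃ v, IsCopy u₁ u₂ m z x n (fun i : Fin n => simulate x i) v then h.choose else 0
termination_by n
decreasing_by all_goals exact i.isLt

/-- The n-th copy is chosen from data that involve only x 0, …, x n. This is the source of
non-anticipation: a copy cannot depend on later choices. -/
lemma simulate_congr {x x' : ℕ → H₁} {n : ℕ} (h : ∀ i ≤ n, x i = x' i) :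
    simulate u₁ u₂ m z x n = simulate u₁ u₂ m z x' n := by
  induction n using Nat.strong_induction_on with
  | _ n ih =>
    have h1 : (fun i : Fin n => simulate u₁ u₂ m z x i) =
        fun i : Fin n => simulate u₁ u₂ m z x' i :=
      funext fun i => ih i i.2 fun j hj => h j (hj.trans i.2.le)
    have h2 : IsCopy u₁ u₂ m z x n = IsCopy u₁ u₂ m z x' n := by
      funext y v
      have : ∀ i : Fin n, x i = x' i := fun i => h i i.2.le
      simp only [IsCopy, h n le_rfl, this]
    rw [simulate, simulate, h1, h2]

variable {u₁ u₂ m z}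

/-- The span condition keeps the induction going: earlier copies lie in the span of earlier m and z,
so both u₂ - m n and z n are orthogonal to them, as `exists_gram_extension` requires. -/
lemma isCopy_simulate (hu : ‖u₁‖ = ‖u₂‖) (hm : ∀ n, ∀ i ≤ n, inner ℝ (u₂ - m n) (m i) = 0)
    (hzm : ∀ n i, inner ℝ (z n) (m i) = 0) (hzu : ∀ n, inner ℝ (z n) u₂ = 0)
    (hz : Orthonormal ℝ z) {x : ℕ → H₁}
    (hdist : ∀ n, ∀ v ∈ Submodule.span ℝ (x '' Set.Iic n), ‖u₂ - m n‖ ≤ ‖u₁ - v‖) (n : ℕ) :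
    simulate u₁ u₂ m z x n ∈ Submodule.span ℝ (m '' Set.Iic n ∪ z '' Set.Iic n) ∧
      (∀ i < n, inner ℝ (simulate u₁ u₂ m z x n) (simulate u₁ u₂ m z x i) =
        inner ℝ (x n) (x i)) ∧
      inner ℝ u₂ (simulate u₁ u₂ m z x n) = inner ℝ u₁ (x n) ∧
      ‖simulate u₁ u₂ m z x n‖ = ‖x n‖ := by
  induction n using Nat.strong_induction_on with
  | _ n ih =>
    have hortho : ∀ a : H₂, (∀ i < n, inner ℝ a (m i) = 0) → (∀ i < n, inner ℝ a (z i) = 0) →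
        ∀ i < n, inner ℝ a (simulate u₁ u₂ m z x i) = 0 := by
      intro a h1 h2 i hi
      have : Submodule.span ℝ (m '' Set.Iic i ∪ z '' Set.Iic i) ≤ LinearMap.ker (innerₛₗ ℝ a) := by
        rw [Submodule.span_le]
        rintro v (⟨j, hj, rfl⟩ | ⟨j, hj, rfl⟩)
        · simpa using h1 j (lt_of_le_of_lt hj hi)
        · simpa using h2 j (lt_of_le_of_lt hj hi)
      simpa using this (ih i hi).1
    have hex : ∃ v, IsCopy u₁ u₂ m z x n (fun i : Fin n => simulate u₁ u₂ m z x i) v := by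
      obtain ⟨v, hv⟩ := exists_gram_extension (x := fun i : Fin n => x i)
        (y := fun i : Fin n => simulate u₁ u₂ m z x i) (u₁ := u₁) (u₂ := u₂) (m := m n) (z := z n)
        (x' := x n) (fun i j => by
          rcases lt_trichotomy i j with hij | rfl | hij
          · rw [real_inner_comm, ← (ih j j.2).2.1 i hij, real_inner_comm]
          · rw [real_inner_self_eq_norm_sq, real_inner_self_eq_norm_sq, (ih i i.2).2.2.2]
          · rw [← (ih i i.2).2.1 j hij])
        (fun i => (ih i i.2).2.2.1.symm) hu
        (fun i => hortho _ (fun j hj => hm n j hj.le)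
          (fun j hj => by rw [real_inner_comm, inner_sub_right, hzu, hzm, sub_zero]) i i.2)
        (hm n n le_rfl)
        (fun i => hortho _ (fun j _ => hzm n j) (fun j hj => hz.2 hj.ne') i i.2)
        (hzm n n) (hzu n) (hz.1 n)
        (fun v hv => hdist n v (Submodule.span_mono (by
          rintro _ (rfl | ⟨i, rfl⟩)
          · exact ⟨n, Set.self_mem_Iic, rfl⟩
          · exact ⟨i, i.2.le, rfl⟩) hv))
      exact ⟨v, hv.1, hv.2.1, hv.2.2.1, hv.2.2.2⟩
    have hcopy : IsCopy u₁ u₂ m z x n (fun i : Fin n => simulate u₁ u₂ m z x i)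
        (simulate u₁ u₂ m z x n) := by
      have : simulate u₁ u₂ m z x n = hex.choose := by rw [simulate, dif_pos hex]
      rw [this]; exact hex.choose_spec
    refine ⟨?_, fun i hi => hcopy.2.1 ⟨i, hi⟩, hcopy.2.2.1, hcopy.2.2.2⟩
    refine Submodule.span_le.2 ?_ hcopy.1
    rintro v (rfl | rfl | ⟨i, rfl⟩)
    · exact Submodule.subset_span (Or.inr ⟨n, Set.self_mem_Iic, rfl⟩)
    · exact Submodule.subset_span (Or.inl ⟨n, Set.self_mem_Iic, rfl⟩)
    · exact Submodule.span_mono (Set.union_subset_union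
        (Set.image_mono (Set.Iic_subset_Iic.2 i.2.le))
        (Set.image_mono (Set.Iic_subset_Iic.2 i.2.le))) (ih i i.2).1

lemma inner_simulate (hu : ‖u₁‖ = ‖u₂‖) (hm : ∀ n, ∀ i ≤ n, inner ℝ (u₂ - m n) (m i) = 0)
    (hzm : ∀ n i, inner ℝ (z n) (m i) = 0) (hzu : ∀ n, inner ℝ (z n) u₂ = 0)
    (hz : Orthonormal ℝ z) {x : ℕ → H₁}
    (hdist : ∀ n, ∀ v ∈ Submodule.span ℝ (x '' Set.Iic n), ‖u₂ - m n‖ ≤ ‖u₁ - v‖) (i j : ℕ) :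
    inner ℝ (simulate u₁ u₂ m z x i) (simulate u₁ u₂ m z x j) = inner ℝ (x i) (x j) := by
  have h := isCopy_simulate hu hm hzm hzu hz hdist
  rcases lt_trichotomy i j with hij | rfl | hij
  · rw [real_inner_comm, (h j).2.1 i hij, real_inner_comm]
  · rw [real_inner_self_eq_norm_sq, real_inner_self_eq_norm_sq, (h i).2.2.2]
  · exact (h i).2.1 j hij

end GramExtension

/-! ### Gaussian processes and extraction of randomness -/

section Gaussian

variable {Ω : Type*} {mΩ : MeasurableSpace Ω} {μ : Measure Ω}

lemma real_inner_toLp {f g : Ω → ℝ} (hf : MemLp f 2 μ) (hg : MemLp g 2 μ) :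
    inner ℝ (hf.toLp f) (hg.toLp g) = ∫ ω, f ω * g ω ∂μ := by
  rw [L2.inner_def]
  refine integral_congr_ae ?_
  filter_upwards [hf.coeFn_toLp, hg.coeFn_toLp] with ω h1 h2
  rw [h1, h2]; simp [mul_comm]

/-- Finite linear combinations of a Gaussian process form a Gaussian process. -/
lemma isGaussianProcess_of_sum {S T : Type*} {X : T → Ω → ℝ} {Y : S → Ω → ℝ}
    (hX : IsGaussianProcess X μ)
    (h : ∀ s, ∃ (I : Finset T) (c : T → ℝ), ∀ ω, Y s ω = ∑ i ∈ I, c i * X i ω) :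
    IsGaussianProcess Y μ := by
  refine hX.of_isGaussianProcess fun s => ?_
  obtain ⟨I, c, hc⟩ := h s
  refine ⟨I, ∑ i : I, c i • ContinuousLinearMap.proj (R := ℝ) i, fun ω => ?_⟩
  rw [hc, ← Finset.sum_coe_sort]
  simp [Finset.restrict_def]

lemma isGaussianProcess_of_iIndepFun {T : Type*} {X : T → Ω → ℝ}
    (hX : ∀ t, HasGaussianLaw (X t) μ) (h : iIndepFun X μ) : IsGaussianProcess X μ where
  hasGaussianLaw I := iIndepFun.hasGaussianLaw (X := fun (i : I) => X i) (fun i => hX i)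
    (h.precomp Subtype.val_injective)

lemma isGaussianProcess_sumElim {S T : Type*} {X : S → Ω → ℝ} {Y : T → Ω → ℝ}
    (hX : IsGaussianProcess X μ) (hY : IsGaussianProcess Y μ)
    (h : IndepFun (fun ω s => X s ω) (fun ω t => Y t ω) μ) :
    IsGaussianProcess (Sum.elim X Y) μ where
  hasGaussianLaw I := by
    have h1 := IndepFun.hasGaussianLaw (hX.hasGaussianLaw I.toLeft) (hY.hasGaussianLaw I.toRight)
      (h.comp (Finset.measurable_restrict _) (Finset.measurable_restrict _))
    let L : ((I.toLeft → ℝ) × (I.toRight → ℝ)) →L[ℝ] (I → ℝ) := ContinuousLinearMap.pi fun i =>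
      match i with
      | ⟨Sum.inl s, hs⟩ => (ContinuousLinearMap.proj (R := ℝ) (φ := fun _ : I.toLeft => ℝ)
          ⟨s, Finset.mem_toLeft.2 hs⟩) ∘L ContinuousLinearMap.fst ℝ _ _
      | ⟨Sum.inr t, ht⟩ => (ContinuousLinearMap.proj (R := ℝ) (φ := fun _ : I.toRight => ℝ)
          ⟨t, Finset.mem_toRight.2 ht⟩) ∘L ContinuousLinearMap.snd ℝ _ _
    have h2 := h1.map_fun L
    have h3 : (fun ω => L (I.toLeft.restrict (X · ω), I.toRight.restrict (Y · ω))) =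
        fun ω => I.restrict (Sum.elim X Y · ω) := by
      funext ω i
      obtain ⟨i | i, hi⟩ := i <;> rfl
    exact h3 ▸ h2

/-- The law of a centred Gaussian process is determined by its covariances. -/
lemma map_eq_of_isGaussianProcess {T : Type*} {X Y : T → Ω → ℝ} [IsProbabilityMeasure μ]
    (hX : IsGaussianProcess X μ) (hY : IsGaussianProcess Y μ)
    (mX : ∀ t, Measurable (X t)) (mY : ∀ t, Measurable (Y t))
    (hX0 : ∀ t, ∫ ω, X t ω ∂μ = 0) (hY0 : ∀ t, ∫ ω, Y t ω ∂μ = 0)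
    (h : ∀ s t, ∫ ω, X s ω * X t ω ∂μ = ∫ ω, Y s ω * Y t ω ∂μ) :
    μ.map (fun ω t => X t ω) = μ.map (fun ω t => Y t ω) := by
  classical
  rw [map_eq_iff_forall_finset_map_restrict_eq (measurable_pi_iff.2 mX).aemeasurable
    (measurable_pi_iff.2 mY).aemeasurable]
  intro I
  -- A Gaussian law is determined by the mean and variance of each linear functional, and the
  -- variance is a quadratic form in the covariances.
  have key : ∀ {Z : T → Ω → ℝ}, IsGaussianProcess Z μ → (∀ t, ∫ ω, Z t ω ∂μ = 0) →
      ∀ L : StrongDual ℝ (I → ℝ), (∫ ω, L (I.restrict (Z · ω)) ∂μ = 0) ∧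
        Var[fun ω => L (I.restrict (Z · ω)); μ] =
          ∑ i : I, ∑ j : I, L (Pi.single i 1) * L (Pi.single j 1) * ∫ ω, Z i ω * Z j ω ∂μ := by
    intro Z hZ hZ0 L
    have hL : ∀ ω, L (I.restrict (Z · ω)) = ∑ i : I, L (Pi.single i 1) * Z i ω := fun ω => by
      have : (I.restrict (Z · ω) : I → ℝ) = ∑ i : I, Z i ω • (Pi.single i 1 : I → ℝ) := by
        rw [← Finset.univ_sum_single (I.restrict (Z · ω))]
        refine Finset.sum_congr rfl fun i _ => ?_
        ext j
        by_cases hij : j = i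
        · subst hij; simp
        · simp [hij]
      rw [this, map_sum]
      simp [mul_comm]
    have hm : ∀ t, MemLp (Z t) 2 μ := fun t => (hZ.hasGaussianLaw_eval t).memLp_two
    have hint : ∀ t, Integrable (Z t) μ := fun t => (hZ.hasGaussianLaw_eval t).integrable
    have h0 : ∫ ω, L (I.restrict (Z · ω)) ∂μ = 0 := by
      simp_rw [hL]
      rw [integral_finsetSum]
      swap
      · exact fun i _ => (hint i).const_mul _
      simp [integral_const_mul, hZ0]
    have hprod : ∀ i j : I, Integrable
        (fun ω => L (Pi.single i 1) * Z i ω * (L (Pi.single j 1) * Z j ω)) μ := fun i j =>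
      (((hm i).integrable_mul (hm j)).const_mul (L (Pi.single i 1) * L (Pi.single j 1))).congr
        (.of_forall fun ω => by simp only [Pi.mul_apply]; ring)
    refine ⟨h0, ?_⟩
    rw [variance_of_integral_eq_zero ?_ h0]
    · simp_rw [hL, sq, Finset.sum_mul_sum]
      rw [integral_finsetSum]
      · refine Finset.sum_congr rfl fun i _ => ?_
        rw [integral_finsetSum]
        · refine Finset.sum_congr rfl fun j _ => ?_
          rw [← integral_const_mul]
          refine integral_congr_ae (.of_forall fun ω => ?_)
          simp only; ring
        · intro j _
          exact hprod i j
      · intro i _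
        refine integrable_finsetSum _ fun j _ => ?_
        exact hprod i j
    · exact ((hZ.hasGaussianLaw I).map_fun L).aemeasurable
  have := (hX.hasGaussianLaw I).isGaussian_map
  have := (hY.hasGaussianLaw I).isGaussian_map
  refine Measure.ext_of_charFunDual ?_
  ext L
  rw [(hX.hasGaussianLaw I).charFunDual_map_eq_fun, (hY.hasGaussianLaw I).charFunDual_map_eq_fun,
    (key hX hX0 L).2, (key hY hY0 L).2, (key hX hX0 L).1, (key hY hY0 L).1]
  simp_rw [h]

lemma continuous_cdf (ν : Measure ℝ) [IsProbabilityMeasure ν] [NullSingletonClass ν] :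
    Continuous (cdf ν) := by
  rw [continuous_iff_continuousAt]
  intro a
  rw [(monotone_cdf ν).continuousAt_iff_leftLim_eq_rightLim, (cdf ν).rightLim_eq]
  have h := (cdf ν).measure_singleton a
  rw [measure_cdf, measure_singleton] at h
  have h1 := (monotone_cdf ν).leftLim_le (le_refl a)
  have h2 := ENNReal.ofReal_eq_zero.1 h.symm
  linarith

/-- The distribution function of an atomless law transforms it into the uniform law. -/
lemma map_cdf_eq_volume (ν : Measure ℝ) [IsProbabilityMeasure ν] [NullSingletonClass ν] :
    ν.map (fun x => (⟨cdf ν x, cdf_nonneg ν x, cdf_le_one ν x⟩ : unitInterval)) = volume := by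
  have hc := continuous_cdf ν
  have hmeas : Measurable fun x => (⟨cdf ν x, cdf_nonneg ν x, cdf_le_one ν x⟩ : unitInterval) :=
    hc.measurable.subtype_mk
  have := Measure.isProbabilityMeasure_map (μ := ν) hmeas.aemeasurable
  have hsurj : ∀ a : ℝ, 0 < a → a < 1 → ∃ x, cdf ν x = a := by
    intro a h0 h1
    refine mem_range_of_exists_le_of_exists_ge hc ?_ ?_
    · exact ((tendsto_cdf_atBot ν).eventually_le_const h0).exists
    · exact ((tendsto_cdf_atTop ν).eventually_const_le h1).exists
  have hIic : ∀ x, ν (Set.Iic x) = ENNReal.ofReal (cdf ν x) := fun x => (ofReal_cdf ν x).symm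
  refine Measure.ext_of_Iic _ _ fun a => ?_
  rw [Measure.map_apply hmeas measurableSet_Iic, unitInterval.volume_Iic]
  have hset : (fun x => (⟨cdf ν x, cdf_nonneg ν x, cdf_le_one ν x⟩ : unitInterval)) ⁻¹' Set.Iic a =
      {x | cdf ν x ≤ a} := by
    ext x; simp [← Subtype.coe_le_coe]
  rw [hset]
  rcases a.2.2.lt_or_eq with h1 | h1
  · refine le_antisymm ?_ ?_
    -- The distribution function may be flat at level a, so {cdf ≤ a} is enclosed in half-lines
    -- whose mass b decreases to a.
    · refine le_of_forall_gt_imp_ge_of_dense fun b hb => ?_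
      rcases le_or_gt 1 b with hb1 | hb1
      · exact prob_le_one.trans hb1
      have hbt : b ≠ ∞ := (hb1.trans ENNReal.one_lt_top).ne
      have hab : (a : ℝ) < b.toReal := (ENNReal.ofReal_lt_iff_lt_toReal a.2.1 hbt).1 hb
      obtain ⟨y, hy⟩ := hsurj b.toReal (lt_of_le_of_lt a.2.1 hab) (by
        rw [← ENNReal.toReal_one]
        exact (ENNReal.toReal_lt_toReal hbt ENNReal.one_ne_top).2 hb1)
      calc ν {x | cdf ν x ≤ a} ≤ ν (Set.Iic y) := by
            refine measure_mono fun x hx => ?_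
            by_contra hxy
            have := monotone_cdf ν (not_le.1 hxy).le
            rw [hy] at this
            exact absurd (this.trans hx) (not_le.2 hab)
        _ = b := by rw [hIic, hy, ENNReal.ofReal_toReal hbt]
    · rcases a.2.1.lt_or_eq with h0 | h0
      · obtain ⟨x, hx⟩ := hsurj a h0 h1
        rw [← hx, ← hIic]
        exact measure_mono fun y hy => monotone_cdf ν hy
      · rw [← h0]; simp
  · have : {x | cdf ν x ≤ a} = Set.univ := by
      ext x; simpa [h1] using cdf_le_one ν x
    rw [this, h1]; simp

/-- A nondegenerate Gaussian variable can be transformed into a sequence of independent standard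
Gaussian variables. -/
lemma exists_map_gaussianReal_eq_infinitePi {v : ℝ≥0} (hv : v ≠ 0) :
    ∃ ζ : ℝ → ℕ → ℝ, Measurable ζ ∧
      (gaussianReal 0 v).map ζ = Measure.infinitePi fun _ : ℕ => gaussianReal 0 1 := by
  have : NullSingletonClass (gaussianReal 0 v) := nullSingletonClass_gaussianReal hv
  -- A uniform variable can be transformed into any law on a standard Borel space, here that of a
  -- whole normal sequence.
  obtain ⟨f, hf, hf'⟩ :=
    (Measure.infinitePi fun _ : ℕ => gaussianReal 0 1).exists_measurable_map_eq
  have hmeas : Measurable fun x => (⟨cdf (gaussianReal 0 v) x, cdf_nonneg _ x, cdf_le_one _ x⟩ :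
    unitInterval) := (continuous_cdf _).measurable.subtype_mk
  refine ⟨_, hf.comp hmeas, ?_⟩
  rw [← Measure.map_map hf hmeas, map_cdf_eq_volume, hf']

end Gaussian

/-! ### The best linear estimator in an abstract inner product space -/

section Estimator

variable {κ ι H : Type*} [Fintype κ] [DecidableEq κ] [NormedAddCommGroup H] [InnerProductSpace ℝ H]

/-- The coefficients of the best linear estimator of `⟨w, η⟩` after `q k` observations of each
coordinate `η k`. -/
noncomputable def estWeight (S : Matrix κ κ ℝ) (w s : κ → ℝ) (q : κ → ℕ) : κ → ℝ :=
  (S⁻¹ + Matrix.diagonal fun k => q k / s k)⁻¹ *ᵥ w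

/-- The number of observations of each source. -/
def sourceCount (src : ι → κ) (I : Finset ι) (k : κ) : ℕ := (I.filter fun i => src i = k).card

lemma sum_comp_source (src : ι → κ) (I : Finset ι) (f : κ → ℝ) :
    ∑ i ∈ I, f (src i) = ∑ k, sourceCount src I k * f k := by
  rw [← Finset.sum_fiberwise I src]
  refine Finset.sum_congr rfl fun k _ => ?_
  rw [Finset.sum_congr rfl fun i hi => by rw [(Finset.mem_filter.1 hi).2], Finset.sum_const,
    nsmul_eq_mul, sourceCount]

variable [DecidableEq ι] {S : Matrix κ κ ℝ} {w s : κ → ℝ} {src : ι → κ} {η : κ → H} {ε : ι → H}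

/-- The normal equations S⁻¹x + diag(q / s) x = w say that x is the vector of covariances between
the residual and the coordinates η. The noise contributes -x, so the residual is orthogonal to each
observation η + ε. -/
lemma inner_residual (hS : S.PosDef) (hs : ∀ k, 0 < s k)
    (hη : ∀ k l, inner ℝ (η k) (η l) = S k l) (hηε : ∀ k i, inner ℝ (η k) (ε i) = 0)
    (hε : ∀ i j, inner ℝ (ε i) (ε j) = if i = j then s (src i) else 0) (I : Finset ι) :
    let x := estWeight S w s (sourceCount src I)
    let r := ∑ k, w k • η k - ∑ i ∈ I, (x (src i) / s (src i)) • (η (src i) + ε i)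
    (∀ l, inner ℝ r (η l) = x l) ∧ ∀ i ∈ I, inner ℝ r (ε i) = -x (src i) := by
  intro x r
  set q := sourceCount src I with hq
  have hεη : ∀ i k, inner ℝ (ε i) (η k) = 0 := fun i k => by rw [real_inner_comm, hηε]
  refine ⟨fun l => ?_, fun i hi => ?_⟩
  · have hPx := add_diagonal_mulVec_inv_mulVec hS.inv (l := fun k => q k / s k)
      (fun k => div_nonneg (Nat.cast_nonneg _) (hs k).le) w
    have hsymm : ∀ k, S k l = S l k := fun k => by
      simpa using congrFun (congrFun hS.isHermitian.eq l) k
    have h1 : inner ℝ r (η l) = ∑ k, S l k * (w k - q k / s k * x k) := by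
      simp only [r, inner_sub_left, sum_inner, inner_smul_left, inner_add_left, hη, hεη, add_zero]
      rw [sum_comp_source src I fun k => (starRingEnd ℝ) (x k / s k) * S k l, ← hq,
        ← Finset.sum_sub_distrib]
      refine Finset.sum_congr rfl fun k _ => ?_
      rw [hsymm]; simp only [conj_trivial]; ring
    have h2 : ∀ k, w k - q k / s k * x k = (S⁻¹ *ᵥ x) k := fun k => by
      have := congrFun hPx k
      rw [add_diagonal_mulVec_apply] at this
      simp only [x, estWeight]; linarith
    rw [h1]
    simp_rw [h2]
    change (S *ᵥ (S⁻¹ *ᵥ x)) l = x l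
    rw [Matrix.mulVec_mulVec, Matrix.mul_nonsing_inv _ hS.det_pos.ne'.isUnit, Matrix.one_mulVec]
  · simp only [r, inner_sub_left, sum_inner, inner_smul_left, inner_add_left, hηε, hε, zero_add,
      mul_zero, Finset.sum_const_zero, zero_sub, mul_ite, Finset.sum_ite_eq', hi, if_true]
    have := (hs (src i)).ne'
    simp only [conj_trivial]
    field_simp

lemma inner_residual_observation (hS : S.PosDef) (hs : ∀ k, 0 < s k)
    (hη : ∀ k l, inner ℝ (η k) (η l) = S k l) (hηε : ∀ k i, inner ℝ (η k) (ε i) = 0)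
    (hε : ∀ i j, inner ℝ (ε i) (ε j) = if i = j then s (src i) else 0) {I : Finset ι} {i : ι}
    (hi : i ∈ I) :
    inner ℝ (∑ k, w k • η k - ∑ i ∈ I, (estWeight S w s (sourceCount src I) (src i) / s (src i)) •
      (η (src i) + ε i)) (η (src i) + ε i) = 0 := by
  obtain ⟨h1, h2⟩ := inner_residual (w := w) hS hs hη hηε hε I
  rw [inner_add_right, h1, h2 i hi, add_neg_cancel]

/-- The residual is orthogonal to the estimator, so its squared norm is its inner product with the
target, namely w·x. -/
lemma norm_residual_sq (hS : S.PosDef) (hs : ∀ k, 0 < s k)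
    (hη : ∀ k l, inner ℝ (η k) (η l) = S k l) (hηε : ∀ k i, inner ℝ (η k) (ε i) = 0)
    (hε : ∀ i j, inner ℝ (ε i) (ε j) = if i = j then s (src i) else 0) (I : Finset ι) :
    ‖∑ k, w k • η k - ∑ i ∈ I, (estWeight S w s (sourceCount src I) (src i) / s (src i)) •
      (η (src i) + ε i)‖ ^ 2 = allocVar S⁻¹ w s (sourceCount src I) := by
  have h0 : ∀ i ∈ I, _ := fun i hi =>
    inner_residual_observation (w := w) hS hs hη hηε hε (I := I) hi
  have h1 := (inner_residual (w := w) hS hs hη hηε hε I).1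
  set e := ∑ i ∈ I, (estWeight S w s (sourceCount src I) (src i) / s (src i)) •
    (η (src i) + ε i) with he
  set r := ∑ k, w k • η k - e with hr
  have h2 : inner ℝ r e = 0 := by
    rw [he, inner_sum]
    exact Finset.sum_eq_zero fun i hi => by rw [inner_smul_right, h0 i hi, mul_zero]
  have h3 : inner ℝ r r = inner ℝ r (∑ k, w k • η k) - inner ℝ r e := by
    rw [← inner_sub_right]
  have h4 : ∀ l, inner ℝ r (η l) = estWeight S w s (sourceCount src I) l := h1
  rw [← real_inner_self_eq_norm_sq, h3, h2, sub_zero, inner_sum]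
  simp only [inner_smul_right, h4]
  rfl

end Estimator

/-! ### Second moments and joint Gaussianity of states and noise -/

section Model

variable {K B : ℕ} (E : Environment K)

/-- The index of an observation: period, source, and number within the period. -/
abbrev ObsIndex (K B : ℕ) : Type := ℕ × Fin K × Fin B

/-- The deviation of `⟨c_k, θ⟩` from its prior mean. -/
def Environment.stateDev (k : Fin K) (ω : Outcome K B) : ℝ := ∑ i, E.C k i * (ω.1 i - E.mean i)

/-- The prior covariance matrix of the vector `C θ`. -/
def Environment.signalCov : Matrix (Fin K) (Fin K) ℝ := E.C * E.cov * E.Cᵀ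

/-- The noise variances as real numbers. -/
def Environment.noise (k : Fin K) : ℝ := E.noiseVar k

/-- The deviations of the states, as seen by the sources, together with all noise terms. -/
def Environment.base : Fin K ⊕ ObsIndex K B → Outcome K B → ℝ :=
  Sum.elim E.stateDev fun i ω => ω.2 i

lemma Environment.noise_pos (k : Fin K) : 0 < E.noise k := by
  exact_mod_cast E.noiseVar_pos k

instance : IsProbabilityMeasure (E.law B) := by
  unfold Environment.law; infer_instance

@[fun_prop]
lemma Environment.measurable_stateDev (k : Fin K) :
    Measurable (E.stateDev k : Outcome K B → ℝ) := by
  unfold Environment.stateDev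
  refine Finset.measurable_sum _ fun i _ => ?_
  have : Measurable fun ω : Outcome K B => ω.1 i :=
    (PiLp.continuous_apply 2 (fun _ => ℝ) i).measurable.comp measurable_fst
  fun_prop

lemma Environment.measurePreserving_fst :
    MeasurePreserving Prod.fst (E.law B) (multivariateGaussian E.mean E.cov) := by
  unfold Environment.law; exact MeasureTheory.measurePreserving_fst

lemma Environment.measurePreserving_snd :
    MeasurePreserving Prod.snd (E.law B)
      (Measure.infinitePi fun i : ObsIndex K B => gaussianReal 0 (E.noiseVar i.2.1)) := by
  unfold Environment.law; exact MeasureTheory.measurePreserving_snd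

lemma Environment.hasLaw_noise (i : ObsIndex K B) :
    (E.law B).map (fun ω => ω.2 i) = gaussianReal 0 (E.noiseVar i.2.1) := by
  have h := (E.measurePreserving_snd (B := B)).map_eq
  have h2 := Measure.map_map (μ := E.law B) (measurable_pi_apply i) measurable_snd
  rw [h, Measure.infinitePi_map_eval] at h2
  exact h2.symm

/-- The row of `C` of source `k` as a Euclidean vector. -/
def Environment.rowVec (k : Fin K) : EuclideanSpace ℝ (Fin K) := WithLp.toLp 2 (E.C k)

lemma Environment.stateDev_eq (k : Fin K) (ω : Outcome K B) :
    E.stateDev k ω = inner ℝ (E.rowVec k) ω.1 - inner ℝ (E.rowVec k) E.mean := by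
  simp only [stateDev, rowVec, PiLp.inner_apply, mul_sub, Finset.sum_sub_distrib]
  simp [mul_comm]

lemma Environment.iIndepFun_noise :
    iIndepFun (fun (i : ObsIndex K B) (ω : Outcome K B) => ω.2 i) (E.law B) := by
  rw [iIndepFun_iff_map_fun_eq_infinitePi_map (by fun_prop)]
  simp_rw [E.hasLaw_noise]
  exact (E.measurePreserving_snd (B := B)).map_eq

lemma Environment.indepFun_stateDev_noise :
    IndepFun (fun (ω : Outcome K B) k => E.stateDev k ω) (fun ω (i : ObsIndex K B) => ω.2 i)
      (E.law B) := by
  have h : Measurable fun (x : EuclideanSpace ℝ (Fin K)) (k : Fin K) =>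
      inner ℝ (E.rowVec k) x - inner ℝ (E.rowVec k) E.mean := by fun_prop
  have := indepFun_prod (μ := multivariateGaussian E.mean E.cov)
    (ν := Measure.infinitePi fun i : ObsIndex K B => gaussianReal 0 (E.noiseVar i.2.1))
    h measurable_id
  convert! this using 1
  funext ω k
  exact E.stateDev_eq k ω

/-- Joint Gaussianity of states and noise lets later questions of independence and equality in law
be settled by inner products in L². -/
lemma Environment.isGaussianProcess_base : IsGaussianProcess (E.base (B := B)) (E.law B) := by
  refine isGaussianProcess_sumElim ⟨fun I => ?_⟩ ?_ E.indepFun_stateDev_noise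
  · have h : HasGaussianLaw (fun ω : Outcome K B => ω.1 - E.mean) (E.law B) := by
      constructor
      have h1 := Measure.map_map (μ := E.law B)
        (by fun_prop : Measurable fun x : EuclideanSpace ℝ (Fin K) => x - E.mean) measurable_fst
      rw [E.measurePreserving_fst.map_eq] at h1
      change IsGaussian ((E.law B).map ((fun x => x - E.mean) ∘ Prod.fst))
      rw [← h1]
      infer_instance
    have h2 := h.map_fun
      (ContinuousLinearMap.pi fun i : I => (innerSL ℝ (E.rowVec i) :
        EuclideanSpace ℝ (Fin K) →L[ℝ] ℝ))
    have h3 : (fun ω : Outcome K B => (ContinuousLinearMap.pi fun i : I =>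
        (innerSL ℝ (E.rowVec i) : EuclideanSpace ℝ (Fin K) →L[ℝ] ℝ)) (ω.1 - E.mean)) =
        fun ω => I.restrict (E.stateDev · ω) := by
      funext ω i
      simp [E.stateDev_eq, inner_sub_right]
    exact h3 ▸ h2
  · refine isGaussianProcess_of_iIndepFun (fun i => ⟨?_⟩) E.iIndepFun_noise
    rw [E.hasLaw_noise]; infer_instance

lemma Environment.memLp_base (i : Fin K ⊕ ObsIndex K B) : MemLp (E.base i) 2 (E.law B) :=
  (E.isGaussianProcess_base.hasGaussianLaw_eval i).memLp_two

lemma Environment.integral_inner_rowVec (k : Fin K) :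
    ∫ x, inner ℝ (E.rowVec k) x ∂(multivariateGaussian E.mean E.cov) =
      inner ℝ (E.rowVec k) E.mean := by
  have := integral_inner (𝕜 := ℝ) (f := fun x => x) (μ := multivariateGaussian E.mean E.cov)
    IsGaussian.integrable_fun_id (E.rowVec k)
  rw [this, integral_id_multivariateGaussian]

lemma Environment.integral_stateDev (k : Fin K) : ∫ ω, E.stateDev k ω ∂(E.law B) = 0 := by
  simp_rw [E.stateDev_eq]
  rw [← integral_map (μ := E.law B) (φ := Prod.fst) (by fun_prop)
    (f := fun x => inner ℝ (E.rowVec k) x - inner ℝ (E.rowVec k) E.mean)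
    (by fun_prop), E.measurePreserving_fst.map_eq, integral_sub _ (integrable_const _),
    E.integral_inner_rowVec]
  · simp
  · exact (IsGaussian.integrable_fun_id).const_inner _

lemma Environment.integral_base (i : Fin K ⊕ ObsIndex K B) : ∫ ω, E.base i ω ∂(E.law B) = 0 := by
  rcases i with k | i
  · exact E.integral_stateDev k
  · have := integral_map (μ := E.law B) (φ := fun ω => ω.2 i) (by fun_prop)
      (f := fun x : ℝ => x) (by fun_prop)
    rw [E.hasLaw_noise, integral_id_gaussianReal] at this
    exact this.symm

lemma Environment.integral_stateDev_mul_stateDev (k l : Fin K) :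
    ∫ ω, E.stateDev k ω * E.stateDev l ω ∂(E.law B) = E.signalCov k l := by
  simp_rw [E.stateDev_eq]
  rw [← integral_map (μ := E.law B) (φ := Prod.fst) (by fun_prop)
    (f := fun x => (inner ℝ (E.rowVec k) x - inner ℝ (E.rowVec k) E.mean) *
      (inner ℝ (E.rowVec l) x - inner ℝ (E.rowVec l) E.mean))
    (by fun_prop), E.measurePreserving_fst.map_eq]
  have h := covarianceBilin_apply_eq_cov (μ := multivariateGaussian E.mean E.cov)
    (IsGaussian.memLp_two_id) (E.rowVec k) (E.rowVec l)
  rw [covarianceBilin_multivariateGaussian E.cov_posDef.posSemidef, covariance,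
    E.integral_inner_rowVec, E.integral_inner_rowVec] at h
  rw [← h, signalCov, Matrix.mul_assoc, Matrix.mul_apply, dotProduct]
  refine Finset.sum_congr rfl fun i _ => ?_
  rfl

lemma Environment.integral_stateDev_mul_noise (k : Fin K) (i : ObsIndex K B) :
    ∫ ω, E.stateDev k ω * ω.2 i ∂(E.law B) = 0 := by
  have h := (E.indepFun_stateDev_noise (B := B)).comp (measurable_pi_apply k)
    (measurable_pi_apply i)
  have h2 := h.integral_fun_mul_eq_mul_integral
    (E.memLp_base (Sum.inl k)).aestronglyMeasurable
    (E.memLp_base (Sum.inr i)).aestronglyMeasurable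
  refine h2.trans ?_
  have : ∫ ω, ((fun f : Fin K → ℝ => f k) ∘ fun (ω : Outcome K B) k => E.stateDev k ω) ω
    ∂(E.law B) = 0 := E.integral_stateDev k
  rw [this, zero_mul]

lemma Environment.integral_noise_mul_noise (i j : ObsIndex K B) :
    ∫ ω, ω.2 i * ω.2 j ∂(E.law B) = if i = j then E.noise i.2.1 else 0 := by
  have h0 : ∫ ω, ω.2 i ∂(E.law B) = 0 := E.integral_base (Sum.inr i)
  split_ifs with hij
  · subst hij
    have h1 := variance_id_gaussianReal (μ := 0) (v := E.noiseVar i.2.1)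
    rw [← E.hasLaw_noise i, variance_map aemeasurable_id (by fun_prop), Function.id_comp,
      variance_of_integral_eq_zero (by fun_prop) h0] at h1
    rw [Environment.noise, ← h1]
    refine integral_congr_ae (.of_forall fun ω => ?_)
    simp only; ring
  · have h := (E.iIndepFun_noise (B := B)).indepFun hij
    have h2 := h.integral_fun_mul_eq_mul_integral
      (E.memLp_base (Sum.inr i)).aestronglyMeasurable
      (E.memLp_base (Sum.inr j)).aestronglyMeasurable
    rw [h2, h0, zero_mul]

end Model

/-! ### Observations and estimators along a fixed path, in L² -/

section Estimation

variable {K B : ℕ} (E : Environment K)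

/-- The elements of `L²` given by the deviations of the states and the noise terms. -/
noncomputable def Environment.vec (i : Fin K ⊕ ObsIndex K B) : Lp ℝ 2 (E.law B) :=
  (E.memLp_base i).toLp _

/-- The deviation of an observation from its prior mean. -/
def Environment.obsDev (i : ObsIndex K B) (ω : Outcome K B) : ℝ := E.stateDev i.2.1 ω + ω.2 i

/-- The deviation of an observation from its prior mean, as an element of `L²`. -/
noncomputable def Environment.obsVec (i : ObsIndex K B) : Lp ℝ 2 (E.law B) :=
  E.vec (Sum.inl i.2.1) + E.vec (Sum.inr i)

/-- The linear combination of state deviations with coefficients `w`. -/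
def Environment.target (w : Fin K → ℝ) (ω : Outcome K B) : ℝ := ∑ k, w k * E.stateDev k ω

/-- The linear combination of state deviations with coefficients `w`, as an element of `L²`. -/
noncomputable def Environment.targetVec (w : Fin K → ℝ) : Lp ℝ 2 (E.law B) :=
  ∑ k, w k • E.vec (Sum.inl k)

/-- The observations made in the first `T` periods along the path `Q`. -/
def observed (Q : ℕ → Block K B) (T : ℕ) : Finset (ObsIndex K B) :=
  (Finset.range T ×ˢ (Finset.univ : Finset (Fin K × Fin B))).filter
    fun i => (i.2.2 : ℕ) < (Q i.1).1 i.2.1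

/-- The number of observations of each source in the first `T` periods along the path `Q`. -/
def totalCount (Q : ℕ → Block K B) (T : ℕ) (k : Fin K) : ℕ := ∑ t ∈ Finset.range T, (Q t).1 k

/-- The coefficient of an observation of source `k` in the best linear estimator. -/
noncomputable def Environment.estCoeff (w : Fin K → ℝ) (Q : ℕ → Block K B) (T : ℕ) (k : Fin K) :
    ℝ :=
  estWeight E.signalCov w E.noise (totalCount Q T) k / E.noise k

/-- The best linear estimator of the target after `T` periods along the path `Q`. -/
noncomputable def Environment.est (w : Fin K → ℝ) (Q : ℕ → Block K B) (T : ℕ)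
    (ω : Outcome K B) : ℝ :=
  ∑ i ∈ observed Q T, E.estCoeff w Q T i.2.1 * E.obsDev i ω

/-- The best linear estimator of the target, as an element of `L²`. -/
noncomputable def Environment.estVec (w : Fin K → ℝ) (Q : ℕ → Block K B) (T : ℕ) :
    Lp ℝ 2 (E.law B) :=
  ∑ i ∈ observed Q T, E.estCoeff w Q T i.2.1 • E.obsVec i

lemma mem_observed {Q : ℕ → Block K B} {T : ℕ} {i : ObsIndex K B} :
    i ∈ observed Q T ↔ i.1 < T ∧ (i.2.2 : ℕ) < (Q i.1).1 i.2.1 := by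
  simp [observed]

lemma observed_mono (Q : ℕ → Block K B) {T T' : ℕ} (h : T ≤ T') :
    observed Q T ⊆ observed Q T' := fun _ hi =>
  mem_observed.2 ⟨(mem_observed.1 hi).1.trans_le h, (mem_observed.1 hi).2⟩

lemma Block.le (q : Block K B) (k : Fin K) : q.1 k ≤ B := by
  conv_rhs => rw [← q.2]
  exact Finset.single_le_sum (f := q.1) (fun _ _ => Nat.zero_le _) (Finset.mem_univ k)

lemma sourceCount_observed (Q : ℕ → Block K B) (T : ℕ) :
    sourceCount (fun i : ObsIndex K B => i.2.1) (observed Q T) = totalCount Q T := by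
  funext k
  have h : (observed Q T).filter (fun i => i.2.1 = k) =
      (Finset.range T).biUnion fun t => (Finset.univ.filter fun j : Fin B => (j : ℕ) < (Q t).1 k).image
        fun j => ((t, k, j) : ObsIndex K B) := by
    ext ⟨t, k', j⟩
    simp only [Finset.mem_filter, mem_observed, Finset.mem_biUnion, Finset.mem_range,
      Finset.mem_image, Finset.mem_univ, true_and, Prod.mk.injEq]
    constructor
    · rintro ⟨⟨h1, h2⟩, rfl⟩
      exact ⟨t, h1, j, h2, rfl, rfl, rfl⟩
    · rintro ⟨t, h1, j, h2, rfl, rfl, rfl⟩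
      exact ⟨⟨h1, h2⟩, rfl⟩
  rw [sourceCount, h, Finset.card_biUnion, totalCount]
  · refine Finset.sum_congr rfl fun t _ => ?_
    rw [Finset.card_image_of_injective _ fun a b hab => by simpa using hab, Fin.card_filter_val_lt, min_eq_right (Block.le _ _)]
  · intro t _ t' _ htt'
    rw [Function.onFun, Finset.disjoint_left]
    rintro i hi hi'
    simp only [Finset.mem_image] at hi hi'
    obtain ⟨_, _, rfl⟩ := hi
    obtain ⟨_, _, h⟩ := hi'
    exact htt' (congrArg Prod.fst h).symm

lemma Environment.inner_vec (i j : Fin K ⊕ ObsIndex K B) :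
    inner ℝ (E.vec i) (E.vec j) = ∫ ω, E.base i ω * E.base j ω ∂(E.law B) :=
  real_inner_toLp _ _

lemma Environment.inner_vec_inl_inl (k l : Fin K) :
    inner ℝ (E.vec (B := B) (Sum.inl k)) (E.vec (Sum.inl l)) = E.signalCov k l :=
  (E.inner_vec _ _).trans (E.integral_stateDev_mul_stateDev k l)

lemma Environment.inner_vec_inl_inr (k : Fin K) (i : ObsIndex K B) :
    inner ℝ (E.vec (B := B) (Sum.inl k)) (E.vec (Sum.inr i)) = 0 :=
  (E.inner_vec _ _).trans (E.integral_stateDev_mul_noise k i)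

lemma Environment.inner_vec_inr_inr (i j : ObsIndex K B) :
    inner ℝ (E.vec (B := B) (Sum.inr i)) (E.vec (Sum.inr j)) =
      if i = j then E.noise i.2.1 else 0 :=
  (E.inner_vec _ _).trans (E.integral_noise_mul_noise i j)

variable {E} {w : Fin K → ℝ}

lemma inner_residual_obsVec (hS : E.signalCov.PosDef) {Q : ℕ → Block K B} {T : ℕ}
    {i : ObsIndex K B} (hi : i ∈ observed Q T) :
    inner ℝ (E.targetVec w - E.estVec w Q T) (E.obsVec i) = 0 := by
  have h := inner_residual_observation (w := w) (src := fun i : ObsIndex K B => i.2.1) hS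
    E.noise_pos E.inner_vec_inl_inl E.inner_vec_inl_inr E.inner_vec_inr_inr hi
  rwa [sourceCount_observed] at h

lemma norm_target_sub_estVec_sq (hS : E.signalCov.PosDef) (Q : ℕ → Block K B) (T : ℕ) :
    ‖E.targetVec w - E.estVec w Q T‖ ^ 2 = allocVar E.signalCov⁻¹ w E.noise (totalCount Q T) := by
  have h := norm_residual_sq (w := w) (src := fun i : ObsIndex K B => i.2.1) hS
    E.noise_pos E.inner_vec_inl_inl E.inner_vec_inl_inr E.inner_vec_inr_inr (observed Q T)
  rwa [sourceCount_observed] at h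

lemma inner_residual_eq_zero_of_mem_span (hS : E.signalCov.PosDef) {Q : ℕ → Block K B} {T : ℕ}
    {v : Lp ℝ 2 (E.law B)} (hv : v ∈ Submodule.span ℝ (E.obsVec '' (observed Q T : Set _))) :
    inner ℝ (E.targetVec w - E.estVec w Q T) v = 0 := by
  have : Submodule.span ℝ (E.obsVec '' (observed Q T : Set (ObsIndex K B))) ≤
      LinearMap.ker (innerₛₗ ℝ (E.targetVec w - E.estVec w Q T)) := by
    rw [Submodule.span_le]
    rintro _ ⟨i, hi, rfl⟩
    exact LinearMap.mem_ker.2 (inner_residual_obsVec hS hi)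
  exact LinearMap.mem_ker.1 (this hv)

lemma estVec_mem_span (Q : ℕ → Block K B) (T : ℕ) :
    E.estVec w Q T ∈ Submodule.span ℝ (E.obsVec '' (observed Q T : Set _)) :=
  Submodule.sum_mem _ fun i hi => Submodule.smul_mem _ _ (Submodule.subset_span ⟨i, hi, rfl⟩)

/-- The estimator is the orthogonal projection of the target onto the span of the observations, so
Pythagoras applies. -/
lemma norm_residual_le (hS : E.signalCov.PosDef) {Q : ℕ → Block K B} {T : ℕ}
    {v : Lp ℝ 2 (E.law B)} (hv : v ∈ Submodule.span ℝ (E.obsVec '' (observed Q T : Set _))) :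
    ‖E.targetVec w - E.estVec w Q T‖ ≤ ‖E.targetVec w - v‖ := by
  have h := inner_residual_eq_zero_of_mem_span (w := w) hS
    (Submodule.sub_mem _ (estVec_mem_span (w := w) Q T) hv)
  have e : E.targetVec w - v = (E.targetVec w - E.estVec w Q T) + (E.estVec w Q T - v) := by abel
  rw [← sq_le_sq₀ (norm_nonneg _) (norm_nonneg _), e, norm_add_sq_real, h]
  nlinarith [sq_nonneg ‖E.estVec w Q T - v‖]

end Estimation

/-! ### The posterior variance along a fixed path -/

section Myopic

variable {K B : ℕ} (E : Environment K)

lemma Environment.measurable_base (i : Fin K ⊕ ObsIndex K B) : Measurable (E.base i) := by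
  rcases i with k | i
  · exact E.measurable_stateDev k
  · exact (measurable_pi_apply i).comp measurable_snd

@[fun_prop]
lemma Environment.measurable_obsDev (i : ObsIndex K B) : Measurable (E.obsDev i) :=
  (E.measurable_base (Sum.inl i.2.1)).add (E.measurable_base (Sum.inr i))

@[fun_prop]
lemma Environment.measurable_target (w : Fin K → ℝ) :
    Measurable (E.target w : Outcome K B → ℝ) :=
  Finset.measurable_sum _ fun k _ => (E.measurable_stateDev k).const_mul _

lemma Environment.coeFn_obsVec (i : ObsIndex K B) : E.obsVec i =ᵐ[E.law B] E.obsDev i := by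
  filter_upwards [Lp.coeFn_add (E.vec (Sum.inl i.2.1)) (E.vec (Sum.inr i)),
    (E.memLp_base (Sum.inl i.2.1)).coeFn_toLp, (E.memLp_base (Sum.inr i)).coeFn_toLp]
    with ω h1 h2 h3
  rw [obsVec, h1, Pi.add_apply, vec, vec, h2, h3]; rfl

lemma coeFn_sum_smul {Ω ι : Type*} {mΩ : MeasurableSpace Ω} {μ : Measure Ω} {I : Finset ι}
    {c : ι → ℝ} {v : ι → Lp ℝ 2 μ} {f : ι → Ω → ℝ} (h : ∀ i ∈ I, v i =ᵐ[μ] f i) :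
    (∑ i ∈ I, c i • v i : Lp ℝ 2 μ) =ᵐ[μ] fun ω => ∑ i ∈ I, c i * f i ω := by
  classical
  induction I using Finset.induction_on with
  | empty => simp only [Finset.sum_empty]; exact Lp.coeFn_zero ℝ 2 μ
  | insert a I ha ih =>
    rw [Finset.sum_insert ha]
    filter_upwards [Lp.coeFn_add (c a • v a) (∑ i ∈ I, c i • v i), Lp.coeFn_smul (c a) (v a),
      h a (Finset.mem_insert_self a I), ih fun i hi => h i (Finset.mem_insert_of_mem hi)]
      with ω h1 h2 h3 h4
    rw [h1, Pi.add_apply, h2, Pi.smul_apply, h3, h4, Finset.sum_insert ha, smul_eq_mul]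

lemma Environment.coeFn_targetVec (w : Fin K → ℝ) :
    E.targetVec w =ᵐ[E.law B] E.target w :=
  coeFn_sum_smul fun k _ => (E.memLp_base (Sum.inl k)).coeFn_toLp

lemma Environment.coeFn_estVec (w : Fin K → ℝ) (Q : ℕ → Block K B) (T : ℕ) :
    E.estVec w Q T =ᵐ[E.law B] E.est w Q T :=
  coeFn_sum_smul fun i _ => E.coeFn_obsVec i

/-- Being a finite linear combination of the state deviations and the noise terms. -/
def Environment.IsLinear (f : Outcome K B → ℝ) : Prop :=
  ∃ (I : Finset (Fin K ⊕ ObsIndex K B)) (c : Fin K ⊕ ObsIndex K B → ℝ),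
    ∀ ω, f ω = ∑ j ∈ I, c j * E.base j ω

variable {E}

lemma isLinear_base (i : Fin K ⊕ ObsIndex K B) : E.IsLinear (E.base i) :=
  ⟨{i}, fun _ => 1, fun ω => by simp⟩

lemma Environment.IsLinear.const_mul {f : Outcome K B → ℝ} (hf : E.IsLinear f) (a : ℝ) :
    E.IsLinear fun ω => a * f ω := by
  obtain ⟨I, c, h⟩ := hf
  exact ⟨I, fun j => a * c j, fun ω => by simp only [h, Finset.mul_sum, mul_assoc]⟩

lemma Environment.IsLinear.add {f g : Outcome K B → ℝ} (hf : E.IsLinear f) (hg : E.IsLinear g) :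
    E.IsLinear fun ω => f ω + g ω := by
  classical
  obtain ⟨I, c, h⟩ := hf
  obtain ⟨J, d, h'⟩ := hg
  refine ⟨I ∪ J, fun j => (if j ∈ I then c j else 0) + if j ∈ J then d j else 0, fun ω => ?_⟩
  simp only [add_mul, Finset.sum_add_distrib, ite_mul, zero_mul, Finset.sum_ite_mem, h, h',
    Finset.union_inter_cancel_left, Finset.union_inter_cancel_right]

lemma isLinear_zero : E.IsLinear (fun _ : Outcome K B => (0 : ℝ)) := ⟨∅, 0, fun ω => by simp⟩

lemma isLinear_sum {ι : Type*} {I : Finset ι} {f : ι → Outcome K B → ℝ}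
    (h : ∀ i ∈ I, E.IsLinear (f i)) : E.IsLinear fun ω => ∑ i ∈ I, f i ω := by
  classical
  induction I using Finset.induction_on with
  | empty => simpa using isLinear_zero
  | insert a I ha ih =>
    simp only [Finset.sum_insert ha]
    exact (h a (Finset.mem_insert_self a I)).add
      (ih fun i hi => h i (Finset.mem_insert_of_mem hi))

lemma isLinear_obsDev (i : ObsIndex K B) : E.IsLinear (E.obsDev i) :=
  (isLinear_base (Sum.inl i.2.1)).add (isLinear_base (Sum.inr i))

lemma isLinear_target (w : Fin K → ℝ) : E.IsLinear (E.target w : Outcome K B → ℝ) :=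
  isLinear_sum fun k _ => (isLinear_base (Sum.inl k)).const_mul _

lemma isLinear_est (w : Fin K → ℝ) (Q : ℕ → Block K B) (T : ℕ) : E.IsLinear (E.est w Q T) :=
  isLinear_sum fun i _ => (isLinear_obsDev i).const_mul _

lemma isGaussianProcess_of_isLinear {S : Type*} {Y : S → Outcome K B → ℝ}
    (h : ∀ s, E.IsLinear (Y s)) : IsGaussianProcess Y (E.law B) :=
  isGaussianProcess_of_sum E.isGaussianProcess_base h

lemma Environment.IsLinear.memLp {f : Outcome K B → ℝ} (hf : E.IsLinear f) :
    MemLp f 2 (E.law B) :=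
  ((isGaussianProcess_of_isLinear (Y := fun _ : Unit => f) fun _ => hf).hasGaussianLaw_eval
    ()).memLp_two

lemma Environment.IsLinear.measurable {f : Outcome K B → ℝ} (hf : E.IsLinear f) :
    Measurable f := by
  obtain ⟨I, c, h⟩ := hf
  have : f = fun ω => ∑ j ∈ I, c j * E.base j ω := funext h
  rw [this]
  exact Finset.measurable_sum _ fun j _ => (E.measurable_base j).const_mul _

lemma Environment.IsLinear.integral {f : Outcome K B → ℝ} (hf : E.IsLinear f) :
    ∫ ω, f ω ∂(E.law B) = 0 := by
  obtain ⟨I, c, h⟩ := hf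
  simp_rw [h]
  rw [integral_finsetSum]
  · simp [integral_const_mul, E.integral_base]
  · exact fun j _ => ((E.memLp_base j).integrable (by norm_num)).const_mul _

lemma Environment.IsLinear.covariance_eq {f g : Outcome K B → ℝ} (hf : E.IsLinear f)
    (hg : E.IsLinear g) : cov[f, g; E.law B] = ∫ ω, f ω * g ω ∂(E.law B) := by
  rw [covariance_eq_sub hf.memLp hg.memLp, hf.integral, hg.integral]
  simp

lemma integral_mul_eq_inner {Ω : Type*} {mΩ : MeasurableSpace Ω} {μ : Measure Ω} {a b : Lp ℝ 2 μ}
    {f g : Ω → ℝ} (hf : a =ᵐ[μ] f) (hg : b =ᵐ[μ] g) : ∫ ω, f ω * g ω ∂μ = inner ℝ a b := by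
  rw [L2.inner_def]
  refine integral_congr_ae ?_
  filter_upwards [hf, hg] with ω h1 h2
  rw [h1, h2]; simp [mul_comm]

/-- The prior mean of the observations of source `k`. -/
def Environment.signalMean (E : Environment K) (k : Fin K) : ℝ := ∑ i, E.C k i * E.mean i

/-- The realizations along a fixed path of multisets. -/
def Environment.pathHist (E : Environment K) (Q : ℕ → Block K B) (ω : Outcome K B) : ℕ → Obs K B :=
  fun t => E.signal (Q t) t ω

lemma signal_apply (q : Block K B) (t : ℕ) (ω : Outcome K B) (k : Fin K) (j : Fin B) :
    E.signal q t ω k j =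
      if (j : ℕ) < q.1 k then E.signalMean k + E.obsDev (t, k, j) ω else 0 := by
  have : E.stateDev k ω = ∑ i, E.C k i * ω.1 i - E.signalMean k := by
    simp [Environment.stateDev, Environment.signalMean, mul_sub, Finset.sum_sub_distrib]
  simp only [Environment.signal, Environment.obsDev, this]
  congr 1; ring

lemma history_ofPath (Q : ℕ → Block K B) (T : ℕ) (ω : Outcome K B) :
    (AcqStrategy.ofPath Q).history E T ω = fun s : Fin T => E.pathHist Q ω s := by
  induction T with
  | zero => funext s; exact s.elim0
  | succ T ih =>
    rw [AcqStrategy.history, ih]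
    funext s
    refine Fin.lastCases ?_ (fun s => ?_) s
    · rw [Fin.snoc_last]; rfl
    · rw [Fin.snoc_castSucc]; rfl

lemma deviate_ofPath (Q : ℕ → Block K B) (t : ℕ) (q : Block K B) :
    (AcqStrategy.ofPath Q).deviate t q = AcqStrategy.ofPath (Function.update Q t q) := by
  simp only [AcqStrategy.deviate, AcqStrategy.ofPath, AcqStrategy.mk.injEq]
  funext s h
  by_cases hs : s = t
  · subst hs; simp
  · simp [hs]

/-- The estimator as a function of the realizations. -/
noncomputable def Environment.estOfHist (E : Environment K) (w : Fin K → ℝ) (Q : ℕ → Block K B)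
    (T : ℕ) (g : ℕ → Obs K B) : ℝ :=
  ∑ i ∈ observed Q T, E.estCoeff w Q T i.2.1 * (g i.1 i.2.1 i.2.2 - E.signalMean i.2.1)

lemma estOfHist_pathHist (w : Fin K → ℝ) (Q : ℕ → Block K B) (T : ℕ) (ω : Outcome K B) :
    E.estOfHist w Q T (E.pathHist Q ω) = E.est w Q T ω := by
  refine Finset.sum_congr rfl fun i hi => ?_
  rw [Environment.pathHist, signal_apply, if_pos (mem_observed.1 hi).2]
  ring

lemma measurable_signal (q : Block K B) (t : ℕ) : Measurable (E.signal q t) := by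
  refine measurable_pi_iff.2 fun k => measurable_pi_iff.2 fun j => ?_
  simp_rw [signal_apply]
  split_ifs
  · fun_prop
  · fun_prop

lemma measurable_pathHist (Q : ℕ → Block K B) : Measurable (E.pathHist Q) :=
  measurable_pi_iff.2 fun t => measurable_signal (Q t) t

lemma coeFn_residual (w : Fin K → ℝ) (Q : ℕ → Block K B) (T : ℕ) :
    (E.targetVec w - E.estVec w Q T : Lp ℝ 2 (E.law B)) =ᵐ[E.law B]
      fun ω => E.target w ω - E.est w Q T ω := by
  filter_upwards [Lp.coeFn_sub (E.targetVec w) (E.estVec w Q T), E.coeFn_targetVec w,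
    E.coeFn_estVec w Q T] with ω h1 h2 h3
  rw [h1, Pi.sub_apply, h2, h3]

/-- The residual is uncorrelated with each observation made and jointly Gaussian with them, hence
independent of them; the history is a function of these observations. -/
lemma indepFun_residual_history {w : Fin K → ℝ} (hS : E.signalCov.PosDef) (Q : ℕ → Block K B)
    (T : ℕ) :
    IndepFun (fun ω => E.target w ω - E.est w Q T ω)
      (fun ω (s : Fin T) => E.pathHist Q ω s) (E.law B) := by
  have hlin : E.IsLinear fun ω => E.target w ω - E.est w Q T ω := by
    simpa [sub_eq_add_neg] using (isLinear_target w).add ((isLinear_est w Q T).const_mul (-1))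
  have hG : IsGaussianProcess (Sum.elim (fun (_ : Unit) ω => E.target w ω - E.est w Q T ω)
      fun (i : observed Q T) => E.obsDev i.1) (E.law B) := by
    refine isGaussianProcess_of_isLinear ?_
    rintro (_ | i)
    · exact hlin
    · exact isLinear_obsDev i.1
  have hcov : ∀ i : observed Q T,
      cov[fun ω => E.target w ω - E.est w Q T ω, E.obsDev i.1; E.law B] = 0 := fun i => by
    rw [hlin.covariance_eq (isLinear_obsDev i.1), integral_mul_eq_inner
      (coeFn_residual w Q T) (E.coeFn_obsVec i.1)]
    exact inner_residual_obsVec hS i.2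
  have h1 : IndepFun (fun ω (_ : Unit) => E.target w ω - E.est w Q T ω)
      (fun ω (i : observed Q T) => E.obsDev i.1 ω) (E.law B) :=
    hG.indepFun_of_covariance_eq_zero (fun _ => hlin.measurable.aemeasurable)
      (fun i => (E.measurable_obsDev i.1).aemeasurable) fun _ i => hcov i
  let F : (observed Q T → ℝ) → Fin T → Obs K B := fun f s k j =>
    if h : (j : ℕ) < (Q s).1 k then E.signalMean k + f ⟨(s, k, j), mem_observed.2 ⟨s.2, h⟩⟩ else 0
  have hF : Measurable F := by
    refine measurable_pi_iff.2 fun s => measurable_pi_iff.2 fun k => measurable_pi_iff.2 fun j => ?_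
    simp only [F]
    split_ifs
    · fun_prop
    · fun_prop
  have h2 := h1.comp (measurable_pi_apply ()) hF
  convert! h2 using 1
  funext ω s k j
  simp only [Environment.pathHist, signal_apply, F, Function.comp_apply]
  split_ifs <;> rfl

/-- The state splits as M + R with M a function of the history and R centred and independent of it.
The conditional variance is therefore the constant E R². -/
lemma posteriorVariance_ofPath [NeZero K] {w : Fin K → ℝ} (hS : E.signalCov.PosDef)
    (hw : ∀ ω : Outcome K B, ω.1 0 - E.mean 0 = E.target w ω) (Q : ℕ → Block K B) (T : ℕ) :
    (AcqStrategy.ofPath Q).posteriorVariance E T =ᵐ[E.law B]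
      fun _ => allocVar E.signalCov⁻¹ w E.noise (totalCount Q T) := by
  have hhist : (AcqStrategy.ofPath Q).history E T =
      fun ω (s : Fin T) => E.pathHist Q ω s := funext fun ω => history_ofPath Q T ω
  have hmeas : Measurable fun ω (s : Fin T) => E.pathHist Q ω s :=
    measurable_pi_iff.2 fun s => measurable_signal _ _
  unfold AcqStrategy.posteriorVariance
  rw [hhist]
  set m := MeasurableSpace.comap (fun ω (s : Fin T) => E.pathHist Q ω s) inferInstance with hm
  have hle : m ≤ Prod.instMeasurableSpace := hmeas.comap_le
  set R : Outcome K B → ℝ := fun ω => E.target w ω - E.est w Q T ω with hR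
  have hlin : E.IsLinear R := by
    simpa [hR, sub_eq_add_neg] using
      (isLinear_target w).add ((isLinear_est w Q T).const_mul (-1))
  have hind : Indep (MeasurableSpace.comap R inferInstance) m (E.law B) :=
    indepFun_residual_history hS Q T
  have hR0 : (E.law B)[R | m] =ᵐ[E.law B] fun _ => 0 := by
    have := condExp_indep_eq hlin.measurable.comap_le hle
      (comap_measurable R).stronglyMeasurable hind
    rwa [hlin.integral] at this
  have hR2 : (E.law B)[R ^ 2 | m] =ᵐ[E.law B]
      fun _ => allocVar E.signalCov⁻¹ w E.noise (totalCount Q T) := by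
    have h1 := condExp_indep_eq hlin.measurable.comap_le hle
      ((comap_measurable R).pow_const 2).stronglyMeasurable hind
    have h2 : ∫ ω, R ω ^ 2 ∂(E.law B) =
        allocVar E.signalCov⁻¹ w E.noise (totalCount Q T) := by
      have hc := coeFn_residual (E := E) w Q T
      rw [← norm_target_sub_estVec_sq hS, ← real_inner_self_eq_norm_sq,
        ← integral_mul_eq_inner hc hc]
      simp_rw [sq]
      rfl
    rw [h2] at h1
    exact h1
  set M : Outcome K B → ℝ := fun ω => E.mean 0 + E.est w Q T ω with hM
  have hMm : StronglyMeasurable[m] M := by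
    refine Measurable.stronglyMeasurable ?_
    let F : (Fin T → Obs K B) → ℝ := fun g => E.mean 0 + E.estOfHist w Q T
      fun s => if h : s < T then g ⟨s, h⟩ else 0
    have hF : Measurable F := by
      refine measurable_const.add (Finset.measurable_sum _ fun i hi => ?_)
      simp only [(mem_observed.1 hi).1, dif_pos]
      fun_prop
    have : M = F ∘ fun ω (s : Fin T) => E.pathHist Q ω s := by
      funext ω
      simp only [hM, F, Function.comp_apply, ← estOfHist_pathHist]
      congr 1
      refine Finset.sum_congr rfl fun i hi => ?_
      simp [(mem_observed.1 hi).1]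
    rw [this]
    exact hF.comp (comap_measurable _)
  have hMint : Integrable M (E.law B) :=
    (integrable_const _).add ((isLinear_est w Q T).memLp.integrable (by norm_num))
  have hRint : Integrable R (E.law B) := hlin.memLp.integrable (by norm_num)
  have hX : (fun ω : Outcome K B => ω.1 0) = M + R := by
    funext ω
    simp only [hM, hR, Pi.add_apply]
    linarith [hw ω]
  have hcond : (E.law B)[fun ω : Outcome K B => ω.1 0 | m] =ᵐ[E.law B] M := by
    rw [hX]
    filter_upwards [condExp_add hMint hRint m, hR0] with ω h1 h2
    rw [h1, Pi.add_apply, h2, condExp_of_stronglyMeasurable hle hMm hMint, add_zero]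
  refine (condExp_congr_ae (g := R ^ 2) ?_).trans hR2
  filter_upwards [hcond] with ω h
  simp only [Pi.pow_apply, Pi.sub_apply, h]
  congr 1
  have := congrFun hX ω
  simp only [Pi.add_apply] at this
  linarith

end Myopic

/-! ### From fixed paths to adaptive strategies -/

section Adaptive

variable {K B : ℕ} {Z : Type*}

/-- The realizations of each period as a function of the multisets chosen so far and of chance. -/
abbrev World (K B : ℕ) (Z : Type*) : Type _ := (t : ℕ) → (Fin (t + 1) → Block K B) → Z → Obs K B

/-- The choice of `S` in period `t` given a sequence of realizations. -/
def AcqStrategy.choice (S : AcqStrategy K B) (g : ℕ → Obs K B) (t : ℕ) : Block K B :=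
  S.acquire t fun s : Fin t => g s

/-- The realizations when information is acquired according to `S`. -/
def World.adapted (W : World K B Z) (S : AcqStrategy K B) (z : Z) (t : ℕ) : Obs K B :=
  W t (fun s : Fin (t + 1) => S.acquire s fun r : Fin s => W.adapted S z r) z
termination_by t
decreasing_by exact r.2.trans_le (Nat.lt_succ_iff.1 s.2)

/-- The realizations when information is acquired along a fixed path. -/
def World.along (W : World K B Z) (Q : ℕ → Block K B) (z : Z) (t : ℕ) : Obs K B :=
  W t (fun s => Q s) z

lemma AcqStrategy.choice_congr (S : AcqStrategy K B) {g g' : ℕ → Obs K B} {t : ℕ}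
    (h : ∀ s < t, g s = g' s) : S.choice g t = S.choice g' t :=
  congrArg (S.acquire t) (funext fun s => h s s.2)

lemma World.adapted_eq (W : World K B Z) (S : AcqStrategy K B) (z : Z) (t : ℕ) :
    W.adapted S z t = W t (fun s : Fin (t + 1) => S.choice (W.adapted S z) s) z := by
  rw [World.adapted]; rfl

lemma World.adapted_congr {Z' : Type*} (W : World K B Z) (W' : World K B Z') (S : AcqStrategy K B)
    {z : Z} {z' : Z'} {T : ℕ} (h : ∀ t < T, ∀ q, W t q z = W' t q z') :
    ∀ t < T, W.adapted S z t = W'.adapted S z' t := by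
  intro t
  induction t using Nat.strong_induction_on with
  | _ t ih =>
    intro ht
    rw [W.adapted_eq, W'.adapted_eq, h t ht]
    congr 1
    funext s
    exact S.choice_congr fun r hr =>
      ih r (hr.trans_le (Nat.lt_succ_iff.1 s.2)) (lt_of_lt_of_le hr (by omega))

lemma World.adapted_eq_along_of_choice_adapted (W : World K B Z) (S : AcqStrategy K B) {z : Z}
    {Q : ℕ → Block K B} {T : ℕ} (h : ∀ s < T, S.choice (W.adapted S z) s = Q s) :
    ∀ t < T, W.adapted S z t = W.along Q z t := by
  intro t ht
  rw [W.adapted_eq]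
  exact congrArg (fun q => W t q z) (funext fun s => h s (lt_of_lt_of_le s.2 ht))

/-- Here the choices are tested on the realizations along the path, so agreement with the adapted
realizations has to be built up by induction on the period. -/
lemma World.adapted_eq_along_of_choice_along (W : World K B Z) (S : AcqStrategy K B) {z : Z}
    {Q : ℕ → Block K B} {T : ℕ} (h : ∀ s < T, S.choice (W.along Q z) s = Q s) :
    ∀ t < T, W.adapted S z t = W.along Q z t := by
  intro t
  induction t using Nat.strong_induction_on with
  | _ t ih =>
    intro ht
    rw [W.adapted_eq]
    refine congrArg (fun q => W t q z) (funext fun s => ?_)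
    have hs : (s : ℕ) < T := lt_of_lt_of_le s.2 ht
    rw [← h s hs]
    exact S.choice_congr fun r hr =>
      ih r (hr.trans_le (Nat.lt_succ_iff.1 s.2)) (hr.trans hs)

variable [MeasurableSpace Z]

lemma World.measurable_adapted {W : World K B Z} (hW : ∀ t q, Measurable (W t q))
    (S : AcqStrategy K B) (t : ℕ) : Measurable fun z => W.adapted S z t := by
  induction t using Nat.strong_induction_on with
  | _ t ih =>
    have h1 : Measurable fun z (s : Fin (t + 1)) => S.choice (W.adapted S z) s := by
      refine measurable_pi_iff.2 fun s => (S.measurable_acquire s).comp ?_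
      exact measurable_pi_iff.2 fun r => ih r (r.2.trans_le (Nat.lt_succ_iff.1 s.2))
    -- Joint measurability is automatic in the first variable because there are only countably many
    -- sequences of multisets.
    have h2 : Measurable fun p : (Fin (t + 1) → Block K B) × Z => W t p.1 p.2 :=
      measurable_from_prod_countable_right fun q => hW t q
    simp_rw [W.adapted_eq S]
    exact h2.comp (h1.prodMk measurable_id)

lemma World.measurable_along {W : World K B Z} (hW : ∀ t q, Measurable (W t q))
    (Q : ℕ → Block K B) : Measurable (W.along Q) :=
  measurable_pi_iff.2 fun t => hW t _

/-- Two worlds that have the same law along every fixed path have the same law under every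
strategy, over a finite horizon. -/
lemma map_adapted_restrict_eq [Nonempty (Block K B)] {μ : Measure Z} {W W' : World K B Z}
    (hW : ∀ t q, Measurable (W t q)) (hW' : ∀ t q, Measurable (W' t q)) {u : Z → ℝ}
    (hu : Measurable u)
    (h : ∀ Q, μ.map (fun z => (u z, W.along Q z)) = μ.map (fun z => (u z, W'.along Q z)))
    (S : AcqStrategy K B) (T : ℕ) :
    μ.map (fun z => (u z, fun s : Fin T => W.adapted S z s)) =
      μ.map (fun z => (u z, fun s : Fin T => W'.adapted S z s)) := by
  classical
  obtain ⟨b⟩ := ‹Nonempty (Block K B)›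
  let ch : (Fin T → Obs K B) → Fin T → Block K B :=
    fun g s => S.acquire s fun r : Fin s => g ⟨r, r.2.trans s.2⟩
  have hch : Measurable ch := measurable_pi_iff.2 fun s => (S.measurable_acquire s).comp
    (measurable_pi_iff.2 fun r => measurable_pi_apply _)
  -- Countable partition by the choices made in the first T periods. On each cell the adapted
  -- realizations are those along a fixed path, where the two laws agree.
  let A : (Fin T → Block K B) → Set (ℝ × (Fin T → Obs K B)) := fun q => {x | ch x.2 = q}
  have hA : ∀ q, MeasurableSet (A q) := fun q =>
    (hch.comp measurable_snd) (measurableSet_singleton q)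
  have hAu : ⋃ q, A q = Set.univ := Set.eq_univ_of_forall fun x => Set.mem_iUnion.2 ⟨ch x.2, rfl⟩
  have hmeas : ∀ {V : World K B Z}, (∀ t q, Measurable (V t q)) →
      Measurable fun z => (u z, fun s : Fin T => V.adapted S z s) := fun hV =>
    hu.prodMk (measurable_pi_iff.2 fun s => World.measurable_adapted hV S s)
  have hmeas' : ∀ {V : World K B Z}, (∀ t q, Measurable (V t q)) → ∀ Q,
      Measurable fun z => (u z, V.along Q z) := fun hV Q =>
    hu.prodMk (World.measurable_along hV Q)
  -- The filler b in periods from T on is irrelevant, since `res` keeps only the first T periods.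
  let ext : (Fin T → Block K B) → ℕ → Block K B := fun q s => if hs : s < T then q ⟨s, hs⟩ else b
  let res : ℝ × (ℕ → Obs K B) → ℝ × (Fin T → Obs K B) := fun x => (x.1, fun s => x.2 s)
  have hres : Measurable res := by fun_prop
  have key : ∀ {V : World K B Z}, (∀ t q, Measurable (V t q)) → ∀ q s, MeasurableSet s →
      μ.map (fun z => (u z, fun s : Fin T => V.adapted S z s)) (s ∩ A q) =
        μ.map (fun z => (u z, V.along (ext q) z)) (res ⁻¹' (s ∩ A q)) := by
    intro V hV q s hs
    rw [Measure.map_apply (hmeas hV) (hs.inter (hA q)),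
      Measure.map_apply (hmeas' hV _) (hres (hs.inter (hA q)))]
    congr 1
    ext z
    have hiff : ch (fun s : Fin T => V.adapted S z s) = q ↔
        ∀ s < T, S.choice (V.adapted S z) s = ext q s := by
      refine ⟨fun hq s hs => ?_, fun hq => funext fun s => ?_⟩
      · simp only [ext, hs, dif_pos, ← hq]; rfl
      · have := hq s s.2
        simp only [ext, s.2, dif_pos] at this
        exact this
    have hiff' : ch (fun s : Fin T => V.along (ext q) z s) = q ↔
        ∀ s < T, S.choice (V.along (ext q) z) s = ext q s := by
      refine ⟨fun hq s hs => ?_, fun hq => funext fun s => ?_⟩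
      · have := congrFun hq ⟨s, hs⟩
        simp only [ext, hs, dif_pos] at this ⊢
        exact this
      · have := hq s s.2
        simp only [ext, s.2, dif_pos] at this ⊢
        exact this
    simp only [Set.mem_preimage, Set.mem_inter_iff, res, A, Set.mem_ofPred_eq]
    constructor
    · rintro ⟨h1, h2⟩
      have h3 := V.adapted_eq_along_of_choice_adapted S (hiff.1 h2)
      have h4 : (fun s : Fin T => V.adapted S z s) = fun s : Fin T => V.along (ext q) z s :=
        funext fun s => h3 s s.2
      rw [← h4]; exact ⟨h1, h2⟩
    · rintro ⟨h1, h2⟩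
      have h3 := V.adapted_eq_along_of_choice_along S (hiff'.1 h2)
      have h4 : (fun s : Fin T => V.adapted S z s) = fun s : Fin T => V.along (ext q) z s :=
        funext fun s => h3 s s.2
      rw [h4]; exact ⟨h1, h2⟩
  rw [Measure.ext_iff_of_iUnion_eq_univ hAu]
  intro q
  ext s hs
  rw [Measure.restrict_apply hs, Measure.restrict_apply hs, key hW q s hs, key hW' q s hs, h]

/-- Two worlds that have the same law along every fixed path have the same law under every
strategy. -/
lemma map_adapted_eq [Nonempty (Block K B)] {μ : Measure Z} [IsFiniteMeasure μ]
    {W W' : World K B Z}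
    (hW : ∀ t q, Measurable (W t q)) (hW' : ∀ t q, Measurable (W' t q)) {u : Z → ℝ}
    (hu : Measurable u)
    (h : ∀ Q, μ.map (fun z => (u z, W.along Q z)) = μ.map (fun z => (u z, W'.along Q z)))
    (S : AcqStrategy K B) :
    μ.map (fun z => (u z, W.adapted S z)) = μ.map (fun z => (u z, W'.adapted S z)) := by
  have hX : ∀ {V : World K B Z}, (∀ t q, Measurable (V t q)) →
      Measurable fun z (t : ℕ) => (u z, V.adapted S z t) := fun hV =>
    measurable_pi_iff.2 fun t => hu.prodMk (World.measurable_adapted hV S t)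
  -- Pairing u with every coordinate turns the joint law into that of one process, determined by its
  -- finite-dimensional marginals.
  have hproc : μ.map (fun z (t : ℕ) => (u z, W.adapted S z t)) =
      μ.map (fun z (t : ℕ) => (u z, W'.adapted S z t)) := by
    rw [map_eq_iff_forall_finset_map_restrict_eq (X := fun t z => (u z, W.adapted S z t))
      (Y := fun t z => (u z, W'.adapted S z t)) (hX hW).aemeasurable (hX hW').aemeasurable]
    intro I
    let T := I.sup id + 1
    have hT : ∀ t : I, (t : ℕ) < T := fun t => Nat.lt_succ_of_le (Finset.le_sup (f := id) t.2)
    let F : ℝ × (Fin T → Obs K B) → I → ℝ × Obs K B := fun x t => (x.1, x.2 ⟨t, hT t⟩)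
    have hF : Measurable F := by fun_prop
    have hm : ∀ {V : World K B Z}, (∀ t q, Measurable (V t q)) →
        μ.map (fun z => I.restrict fun t => (u z, V.adapted S z t)) =
          (μ.map (fun z => (u z, fun s : Fin T => V.adapted S z s))).map F := fun hV => by
      rw [Measure.map_map hF (hu.prodMk
        (measurable_pi_iff.2 fun s => World.measurable_adapted hV S s))]
      rfl
    rw [hm hW, hm hW', map_adapted_restrict_eq hW hW' hu h]
  let G : (ℕ → ℝ × Obs K B) → ℝ × (ℕ → Obs K B) := fun x => ((x 0).1, fun t => (x t).2)
  have hG : Measurable G := by fun_prop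
  have hm : ∀ {V : World K B Z}, (∀ t q, Measurable (V t q)) →
      μ.map (fun z => (u z, V.adapted S z)) =
        (μ.map (fun z (t : ℕ) => (u z, V.adapted S z t))).map G := fun hV => by
    rw [Measure.map_map hG (hX hV)]; rfl
  rw [hm hW, hm hW', hproc]

/-- The world of the actual realizations. -/
def Environment.world (E : Environment K) : World K B (Outcome K B) :=
  fun t q ω => E.signal (q (Fin.last t)) t ω

lemma Environment.measurable_world (E : Environment K) (t : ℕ) (q : Fin (t + 1) → Block K B) :
    Measurable (E.world t q) := measurable_signal _ _

lemma history_eq_adapted (E : Environment K) (S : AcqStrategy K B) (T : ℕ) (ω : Outcome K B) :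
    S.history E T ω = fun s : Fin T => E.world.adapted S ω s := by
  induction T with
  | zero => funext s; exact s.elim0
  | succ T ih =>
    rw [AcqStrategy.history, ih]
    funext s
    refine Fin.lastCases ?_ (fun s => ?_) s
    · rw [Fin.snoc_last, Fin.val_last, World.adapted_eq]; rfl
    · rw [Fin.snoc_castSucc]; rfl

end Adaptive

/-! ### Randomness taken from the first period -/

section Simulation

/-- An enumeration of the observations in chronological order. -/
lemma exists_obsIndexEquiv (K B : ℕ) [NeZero K] [NeZero B] :
    ∃ e : ObsIndex K B ≃ ℕ, ∀ ⦃m n⦄, m ≤ n → (e.symm m).1 ≤ (e.symm n).1 := by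
  have : NeZero (K * B) := ⟨mul_ne_zero (NeZero.ne K) (NeZero.ne B)⟩
  refine ⟨((Equiv.refl ℕ).prodCongr finProdFinEquiv).trans (Nat.divModEquiv (K * B)).symm,
    fun m n h => ?_⟩
  exact Nat.div_le_div_right h

/-- The data needed to reproduce the realizations of an arbitrary strategy from those along the
path `p`: the coefficients `w` of the target, a chronological enumeration of the observations, two
observations of the same source in the first period, and a transformation `ζ` of their difference
into a sequence of independent standard Gaussian variables. -/
structure Simulator {K : ℕ} (E : Environment K) (B : ℕ) where
  w : Fin K → ℝ
  p : ℕ → Block K B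
  idx : ObsIndex K B ≃ ℕ
  k₀ : Fin K
  j₀ : Fin B
  j₁ : Fin B
  ζ : ℝ → ℕ → ℝ
  signalCov_posDef : E.signalCov.PosDef
  optimal : ∀ T (Q : ℕ → Block K B), allocVar E.signalCov⁻¹ w E.noise (totalCount p T) ≤
    allocVar E.signalCov⁻¹ w E.noise (totalCount Q T)
  idx_mono : ∀ ⦃m n⦄, m ≤ n → (idx.symm m).1 ≤ (idx.symm n).1
  j_ne : j₀ ≠ j₁
  j₀_lt : (j₀ : ℕ) < (p 0).1 k₀
  j₁_lt : (j₁ : ℕ) < (p 0).1 k₀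
  measurable_ζ : Measurable ζ
  map_ζ : (gaussianReal 0 (E.noiseVar k₀ + E.noiseVar k₀)).map ζ =
    Measure.infinitePi fun _ : ℕ => gaussianReal 0 1

namespace Simulator

variable {K B : ℕ} {E : Environment K} (M : Simulator E B)

/-- The period of the `n`-th observation. -/
def period (n : ℕ) : ℕ := (M.idx.symm n).1

/-- The estimator at the end of the period of the `n`-th observation. -/
noncomputable def estAt (n : ℕ) : Outcome K B → ℝ := E.est M.w M.p (M.period n + 1)

/-- The estimator at the end of the period of the `n`-th observation, as an element of `L²`. -/
noncomputable def estVecAt (n : ℕ) : Lp ℝ 2 (E.law B) := E.estVec M.w M.p (M.period n + 1)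

/-- The difference of two observations of the same source in the first period. -/
def gap (g : ℕ → Obs K B) : ℝ := g 0 M.k₀ M.j₀ - g 0 M.k₀ M.j₁

/-- The auxiliary randomness, as a sequence of random variables. -/
def seed (n : ℕ) (ω : Outcome K B) : ℝ := M.ζ (M.gap (E.pathHist M.p ω)) n

/-- Both observations carry the same signal, which cancels and leaves pure noise. -/
lemma gap_pathHist (ω : Outcome K B) :
    M.gap (E.pathHist M.p ω) = ω.2 (0, M.k₀, M.j₀) - ω.2 (0, M.k₀, M.j₁) := by
  simp only [gap, Environment.pathHist, signal_apply, M.j₀_lt, M.j₁_lt, if_true,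
    Environment.obsDev]
  ring

lemma map_gap : (E.law B).map (fun ω => M.gap (E.pathHist M.p ω)) =
    gaussianReal 0 (E.noiseVar M.k₀ + E.noiseVar M.k₀) := by
  simp_rw [gap_pathHist]
  have hne : ((0, M.k₀, M.j₀) : ObsIndex K B) ≠ (0, M.k₀, M.j₁) := fun h => M.j_ne (by simpa using h)
  have h := (E.iIndepFun_noise (B := B)).indepFun hne
  have h1 : HasLaw (fun ω : Outcome K B => ω.2 (0, M.k₀, M.j₀)) (gaussianReal 0 (E.noiseVar M.k₀))
    (E.law B) := ⟨by fun_prop, E.hasLaw_noise _⟩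
  have h2 : HasLaw (fun ω : Outcome K B => -ω.2 (0, M.k₀, M.j₁)) (gaussianReal 0 (E.noiseVar M.k₀))
      (E.law B) := by
    refine ⟨by fun_prop, ?_⟩
    have := gaussianReal_map_neg (μ := 0) (v := E.noiseVar M.k₀)
    rw [neg_zero, ← E.hasLaw_noise (0, M.k₀, M.j₁), Measure.map_map (by fun_prop) (by fun_prop)]
      at this
    rw [E.hasLaw_noise] at this
    exact this
  have h3 := gaussianReal_add_gaussianReal_of_indepFun (h.comp measurable_id measurable_neg)
    h1.map_eq h2.map_eq
  rw [zero_add] at h3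
  rw [← h3]
  congr 1

lemma measurable_gap : Measurable M.gap := by unfold gap; fun_prop

lemma measurable_seed (n : ℕ) : Measurable (M.seed n) :=
  (measurable_pi_apply n).comp
    (M.measurable_ζ.comp (M.measurable_gap.comp (measurable_pathHist M.p)))

lemma map_seed : (E.law B).map (fun ω n => M.seed n ω) =
    Measure.infinitePi fun _ : ℕ => gaussianReal 0 1 := by
  have h := Measure.map_map (μ := E.law B) M.measurable_ζ
    (show Measurable fun ω => M.gap (E.pathHist M.p ω) from
      M.measurable_gap.comp (measurable_pathHist M.p))
  rw [M.map_gap, M.map_ζ] at h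
  exact h.symm

lemma map_seed_apply (n : ℕ) : (E.law B).map (M.seed n) = gaussianReal 0 1 := by
  have h := Measure.map_map (μ := E.law B) (measurable_pi_apply n)
    (measurable_pi_iff.2 M.measurable_seed)
  rw [M.map_seed, Measure.infinitePi_map_eval] at h
  exact h.symm

lemma iIndepFun_seed : iIndepFun M.seed (E.law B) := by
  rw [iIndepFun_iff_map_fun_eq_infinitePi_map M.measurable_seed, M.map_seed]
  simp_rw [M.map_seed_apply]

lemma isGaussianProcess_seed : IsGaussianProcess M.seed (E.law B) :=
  isGaussianProcess_of_iIndepFun (fun n => ⟨by rw [M.map_seed_apply]; infer_instance⟩)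
    M.iIndepFun_seed

lemma memLp_seed (n : ℕ) : MemLp (M.seed n) 2 (E.law B) :=
  (M.isGaussianProcess_seed.hasGaussianLaw_eval n).memLp_two

/-- The auxiliary randomness, as elements of `L²`. -/
noncomputable def seedVec (n : ℕ) : Lp ℝ 2 (E.law B) := (M.memLp_seed n).toLp _

lemma integral_seed (n : ℕ) : ∫ ω, M.seed n ω ∂(E.law B) = 0 := by
  have := integral_map (μ := E.law B) (φ := M.seed n) (M.measurable_seed n).aemeasurable
    (f := fun x : ℝ => x) (by fun_prop)
  rw [M.map_seed_apply, integral_id_gaussianReal] at this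
  exact this.symm

lemma orthonormal_seedVec : Orthonormal ℝ M.seedVec := by
  classical
  rw [orthonormal_iff_ite]
  intro i j
  rw [seedVec, seedVec, real_inner_toLp]
  split_ifs with hij
  · subst hij
    have h1 := variance_id_gaussianReal (μ := 0) (v := 1)
    rw [← M.map_seed_apply i, variance_map aemeasurable_id (M.measurable_seed i).aemeasurable,
      Function.id_comp, variance_of_integral_eq_zero (M.measurable_seed i).aemeasurable
        (M.integral_seed i)] at h1
    rw [← NNReal.coe_one, ← h1]
    refine integral_congr_ae (.of_forall fun ω => ?_)
    simp only; ring
  · have h := M.iIndepFun_seed.indepFun hij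
    have h2 := h.integral_fun_mul_eq_mul_integral (M.memLp_seed i).aestronglyMeasurable
      (M.memLp_seed j).aestronglyMeasurable
    rw [h2, M.integral_seed, zero_mul]

/-- The target together with the estimators. -/
noncomputable def core (o : Option ℕ) : Outcome K B → ℝ := o.elim (E.target M.w) M.estAt

lemma isLinear_core (o : Option ℕ) : E.IsLinear (M.core o) := by
  cases o with
  | none => exact isLinear_target _
  | some n => exact isLinear_est _ _ _

lemma isLinear_gap : E.IsLinear fun ω => M.gap (E.pathHist M.p ω) := by
  have := (isLinear_base (E := E) (Sum.inr (0, M.k₀, M.j₀))).add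
    ((isLinear_base (E := E) (Sum.inr (0, M.k₀, M.j₁))).const_mul (-1))
  simp only [neg_mul, one_mul, ← sub_eq_add_neg] at this
  simp_rw [gap_pathHist]
  exact this

lemma coeFn_gap : (E.vec (Sum.inr (0, M.k₀, M.j₀)) - E.vec (Sum.inr (0, M.k₀, M.j₁)) :
    Lp ℝ 2 (E.law B)) =ᵐ[E.law B] fun ω => M.gap (E.pathHist M.p ω) := by
  filter_upwards [Lp.coeFn_sub (E.vec (Sum.inr (0, M.k₀, M.j₀))) (E.vec (Sum.inr (0, M.k₀, M.j₁))),
    (E.memLp_base (Sum.inr (0, M.k₀, M.j₀))).coeFn_toLp,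
    (E.memLp_base (Sum.inr (0, M.k₀, M.j₁))).coeFn_toLp] with ω h1 h2 h3
  rw [h1, Pi.sub_apply, Environment.vec, Environment.vec, h2, h3, gap_pathHist]
  rfl

lemma inner_targetVec_noise (w : Fin K → ℝ) (i : ObsIndex K B) :
    inner ℝ (E.targetVec w) (E.vec (Sum.inr i)) = 0 := by
  rw [Environment.targetVec, sum_inner]
  exact Finset.sum_eq_zero fun k _ => by
    rw [inner_smul_left, E.inner_vec_inl_inr, mul_zero]

/-- The gap is noise, hence uncorrelated with the target. It is also a difference of two
observations available to every estimator, so the residual is orthogonal to it, and with target and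
residual so is the estimator. -/
lemma integral_core_mul_gap (o : Option ℕ) :
    ∫ ω, M.core o ω * M.gap (E.pathHist M.p ω) ∂(E.law B) = 0 := by
  have htarget : inner ℝ (E.targetVec M.w)
      (E.vec (Sum.inr (0, M.k₀, M.j₀)) - E.vec (Sum.inr (0, M.k₀, M.j₁))) = 0 := by
    rw [inner_sub_right, inner_targetVec_noise, inner_targetVec_noise, sub_zero]
  cases o with
  | none => exact (integral_mul_eq_inner (E.coeFn_targetVec M.w) M.coeFn_gap).trans htarget
  | some n =>
    refine (integral_mul_eq_inner (E.coeFn_estVec M.w M.p (M.period n + 1)) M.coeFn_gap).trans ?_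
    have h0 := inner_residual_obsVec (w := M.w) M.signalCov_posDef (Q := M.p)
      (T := M.period n + 1) (i := (0, M.k₀, M.j₀)) (mem_observed.2 ⟨Nat.succ_pos _, M.j₀_lt⟩)
    have h1 := inner_residual_obsVec (w := M.w) M.signalCov_posDef (Q := M.p)
      (T := M.period n + 1) (i := (0, M.k₀, M.j₁)) (mem_observed.2 ⟨Nat.succ_pos _, M.j₁_lt⟩)
    have e : (E.vec (Sum.inr (0, M.k₀, M.j₀)) - E.vec (Sum.inr (0, M.k₀, M.j₁)) :
        Lp ℝ 2 (E.law B)) = E.obsVec (0, M.k₀, M.j₀) - E.obsVec (0, M.k₀, M.j₁) := by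
      simp only [Environment.obsVec]; abel
    have h2 : inner ℝ (E.targetVec M.w - E.estVec M.w M.p (M.period n + 1))
        (E.vec (Sum.inr (0, M.k₀, M.j₀)) - E.vec (Sum.inr (0, M.k₀, M.j₁))) = 0 := by
      rw [e, inner_sub_right, h0, h1, sub_zero]
    rw [inner_sub_left, htarget] at h2
    linarith

/-- Zero correlation gives independence from the gap by joint Gaussianity, and the seeds are
functions of the gap alone. -/
lemma indepFun_core_seed :
    IndepFun (fun ω o => M.core o ω) (fun ω n => M.seed n ω) (E.law B) := by
  have hG : IsGaussianProcess (Sum.elim M.core fun (_ : Unit) ω => M.gap (E.pathHist M.p ω))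
      (E.law B) := by
    refine isGaussianProcess_of_isLinear ?_
    rintro (o | _)
    · exact M.isLinear_core o
    · exact M.isLinear_gap
  have h := hG.indepFun_of_covariance_eq_zero
    (fun o => (M.isLinear_core o).measurable.aemeasurable)
    (fun _ => M.isLinear_gap.measurable.aemeasurable) fun o _ => by
      rw [(M.isLinear_core o).covariance_eq M.isLinear_gap, M.integral_core_mul_gap]
  exact h.comp measurable_id (M.measurable_ζ.comp (measurable_pi_apply ()))

/-- The target, the estimators and the auxiliary randomness. -/
noncomputable def source : Option ℕ ⊕ ℕ → Outcome K B → ℝ := Sum.elim M.core M.seed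

/-- The seeds depend nonlinearly on the gap, so they are not covered by `IsLinear`; joint
Gaussianity comes from independence. -/
lemma isGaussianProcess_source : IsGaussianProcess M.source (E.law B) :=
  isGaussianProcess_sumElim (isGaussianProcess_of_isLinear M.isLinear_core)
    M.isGaussianProcess_seed M.indepFun_core_seed

lemma integral_source (i : Option ℕ ⊕ ℕ) : ∫ ω, M.source i ω ∂(E.law B) = 0 := by
  rcases i with o | n
  · exact (M.isLinear_core o).integral
  · exact M.integral_seed n

lemma integral_seed_mul_core (n : ℕ) (o : Option ℕ) :
    ∫ ω, M.seed n ω * M.core o ω ∂(E.law B) = 0 := by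
  have h := (M.indepFun_core_seed.comp (measurable_pi_apply o) (measurable_pi_apply n)).symm
  have h2 := h.integral_fun_mul_eq_mul_integral (M.memLp_seed n).aestronglyMeasurable
    (M.isLinear_core o).memLp.aestronglyMeasurable
  refine h2.trans ?_
  have : ∫ ω, ((fun f : ℕ → ℝ => f n) ∘ fun (ω : Outcome K B) n => M.seed n ω) ω
    ∂(E.law B) = 0 := M.integral_seed n
  rw [this, zero_mul]

lemma inner_seedVec_estVecAt (n i : ℕ) : inner ℝ (M.seedVec n) (M.estVecAt i) = 0 :=
  (integral_mul_eq_inner (M.memLp_seed n).coeFn_toLp (E.coeFn_estVec _ _ _)).symm.trans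
    (M.integral_seed_mul_core n (some i))

lemma inner_seedVec_targetVec (n : ℕ) : inner ℝ (M.seedVec n) (E.targetVec M.w) = 0 :=
  (integral_mul_eq_inner (M.memLp_seed n).coeFn_toLp (E.coeFn_targetVec _)).symm.trans
    (M.integral_seed_mul_core n none)

end Simulator

end Simulation

/-! ### Causal copies of the observations along an arbitrary path -/

namespace Simulator

variable {K B : ℕ} {E : Environment K} (M : Simulator E B)

/-- The `n`-th observation along the path `Q`, or `0` if it is not made. -/
noncomputable def obsSeq (Q : ℕ → Block K B) (n : ℕ) : Lp ℝ 2 (E.law B) :=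
  if ((M.idx.symm n).2.2 : ℕ) < (Q (M.idx.symm n).1).1 (M.idx.symm n).2.1 then
    E.obsVec (M.idx.symm n) else 0

/-- The simulated counterpart of `obsSeq`. -/
noncomputable def copy (Q : ℕ → Block K B) (n : ℕ) : Lp ℝ 2 (E.law B) :=
  simulate (E.targetVec M.w) (E.targetVec M.w) M.estVecAt M.seedVec (M.obsSeq Q) n

lemma period_mono {m n : ℕ} (h : m ≤ n) : M.period m ≤ M.period n := M.idx_mono h

/-- The estimators project onto an increasing family of subspaces, so an earlier estimator lies in
the space to which the later residual is orthogonal. -/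
lemma inner_residual_estVecAt (n : ℕ) (i : ℕ) (h : i ≤ n) :
    inner ℝ (E.targetVec M.w - M.estVecAt n) (M.estVecAt i) = 0 := by
  refine inner_residual_eq_zero_of_mem_span M.signalCov_posDef
    (Submodule.span_mono (Set.image_mono ?_) (estVec_mem_span (w := M.w) M.p (M.period i + 1)))
  exact Finset.coe_subset.2 (observed_mono _ (Nat.succ_le_succ (M.period_mono h)))

/-- This is where uniform optimality of `M.p` enters: the observations of `Q` numbered up to n all
fall in the first `M.period n + 1` periods, and after that many periods no path has a smaller
residual variance. -/
lemma norm_residual_estVecAt_le (Q : ℕ → Block K B) (n : ℕ) (v : Lp ℝ 2 (E.law B))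
    (hv : v ∈ Submodule.span ℝ (M.obsSeq Q '' Set.Iic n)) :
    ‖E.targetVec M.w - M.estVecAt n‖ ≤ ‖E.targetVec M.w - v‖ := by
  have h1 : v ∈ Submodule.span ℝ (E.obsVec '' (observed Q (M.period n + 1) : Set _)) := by
    refine Submodule.span_le.2 ?_ hv
    rintro _ ⟨i, hi, rfl⟩
    rw [obsSeq]
    split_ifs with h
    · exact Submodule.subset_span
        ⟨_, mem_observed.2 ⟨Nat.lt_succ_of_le (M.period_mono hi), h⟩, rfl⟩
    · exact Submodule.zero_mem _
  refine le_trans ?_ (norm_residual_le (w := M.w) M.signalCov_posDef h1)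
  rw [← sq_le_sq₀ (norm_nonneg _) (norm_nonneg _), estVecAt,
    norm_target_sub_estVec_sq M.signalCov_posDef, norm_target_sub_estVec_sq M.signalCov_posDef]
  exact M.optimal _ _

lemma copy_mem_span (Q : ℕ → Block K B) (n : ℕ) :
    M.copy Q n ∈ Submodule.span ℝ (M.estVecAt '' Set.Iic n ∪ M.seedVec '' Set.Iic n) :=
  (isCopy_simulate rfl M.inner_residual_estVecAt M.inner_seedVec_estVecAt
    M.inner_seedVec_targetVec M.orthonormal_seedVec (M.norm_residual_estVecAt_le Q) n).1

lemma inner_targetVec_copy (Q : ℕ → Block K B) (n : ℕ) :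
    inner ℝ (E.targetVec M.w) (M.copy Q n) = inner ℝ (E.targetVec M.w) (M.obsSeq Q n) :=
  (isCopy_simulate rfl M.inner_residual_estVecAt M.inner_seedVec_estVecAt
    M.inner_seedVec_targetVec M.orthonormal_seedVec (M.norm_residual_estVecAt_le Q) n).2.2.1

lemma inner_copy_copy (Q : ℕ → Block K B) (m n : ℕ) :
    inner ℝ (M.copy Q m) (M.copy Q n) = inner ℝ (M.obsSeq Q m) (M.obsSeq Q n) :=
  inner_simulate rfl M.inner_residual_estVecAt M.inner_seedVec_estVecAt
    M.inner_seedVec_targetVec M.orthonormal_seedVec (M.norm_residual_estVecAt_le Q) m n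

lemma copy_congr {Q Q' : ℕ → Block K B} {n : ℕ} (h : ∀ s ≤ M.period n, Q s = Q' s) :
    M.copy Q n = M.copy Q' n :=
  simulate_congr _ _ _ _ fun i hi => by
    rw [obsSeq, obsSeq, h (M.idx.symm i).1 (M.period_mono hi)]

/-- The estimators and the auxiliary randomness from which the copies are built. -/
noncomputable def genVec : ℕ ⊕ ℕ → Lp ℝ 2 (E.law B) := Sum.elim M.estVecAt M.seedVec

/-- The estimators and the auxiliary randomness as functions of the realizations. -/
noncomputable def genOfHist (g : ℕ → Obs K B) : ℕ ⊕ ℕ → ℝ :=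
  Sum.elim (fun n => E.estOfHist M.w M.p (M.period n + 1) g) (M.ζ (M.gap g))

lemma genOfHist_pathHist (i : ℕ ⊕ ℕ) (ω : Outcome K B) :
    M.genOfHist (E.pathHist M.p ω) i = M.source (Sum.map some id i) ω := by
  rcases i with n | n
  · exact estOfHist_pathHist _ _ _ _
  · rfl

lemma coeFn_genVec (i : ℕ ⊕ ℕ) :
    M.genVec i =ᵐ[E.law B] fun ω => M.genOfHist (E.pathHist M.p ω) i := by
  simp_rw [genOfHist_pathHist]
  rcases i with n | n
  · exact E.coeFn_estVec _ _ _
  · exact (M.memLp_seed n).coeFn_toLp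

lemma measurable_genOfHist (i : ℕ ⊕ ℕ) : Measurable fun g => M.genOfHist g i := by
  rcases i with n | n
  · exact Finset.measurable_sum _ fun i _ => by fun_prop
  · exact (measurable_pi_apply n).comp (M.measurable_ζ.comp M.measurable_gap)

/-- Causality of the ingredients: an estimator reads only periods up to its own, and the seeds read
only the first period. -/
lemma genOfHist_congr {g g' : ℕ → Obs K B} {t n : ℕ} (hn : M.period n ≤ t)
    (h : ∀ s ≤ t, g s = g' s) {i : ℕ ⊕ ℕ}
    (hi : i ∈ (Finset.Iic n).disjSum (Finset.Iic n)) : M.genOfHist g i = M.genOfHist g' i := by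
  rcases i with i | i
  · have hi' : i ≤ n := by simpa using hi
    refine Finset.sum_congr rfl fun o ho => ?_
    have h1 := (mem_observed.1 ho).1
    have h2 := M.period_mono hi'
    rw [h o.1 (by omega)]
  · simp only [genOfHist, Sum.elim_inr, gap, h 0 (Nat.zero_le t)]

lemma exists_copy_eq_sum (Q : ℕ → Block K B) (n : ℕ) :
    ∃ c : ℕ ⊕ ℕ → ℝ,
      M.copy Q n = ∑ i ∈ (Finset.Iic n).disjSum (Finset.Iic n), c i • M.genVec i := by
  have h : M.estVecAt '' Set.Iic n ∪ M.seedVec '' Set.Iic n =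
      M.genVec '' ((Finset.Iic n).disjSum (Finset.Iic n) : Finset (ℕ ⊕ ℕ)) := by
    ext v
    simp [genVec]
  obtain ⟨c, hc⟩ := (Submodule.mem_span_image_finset_iff_exists_fun' ℝ).1 (h ▸ M.copy_mem_span Q n)
  exact ⟨c, hc.symm⟩

open Classical in
/-- The coefficients of a linear combination of the first estimators and seeds. -/
noncomputable def coeffOf (n : ℕ) (v : Lp ℝ 2 (E.law B)) : ℕ ⊕ ℕ → ℝ :=
  -- The coefficients depend on the vector alone, so equal copies receive equal coefficients and
  -- `simDev_congr` holds at every point, not merely almost everywhere.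
  if h : ∃ c : ℕ ⊕ ℕ → ℝ, v = ∑ i ∈ (Finset.Iic n).disjSum (Finset.Iic n), c i • M.genVec i
  then h.choose else 0

lemma copy_eq_sum (Q : ℕ → Block K B) (n : ℕ) :
    M.copy Q n =
      ∑ i ∈ (Finset.Iic n).disjSum (Finset.Iic n), M.coeffOf n (M.copy Q n) i • M.genVec i := by
  have h := M.exists_copy_eq_sum Q n
  rw [coeffOf, dif_pos h]
  exact h.choose_spec

/-- The simulated deviation of an observation from its prior mean. -/
noncomputable def simDev (Q : ℕ → Block K B) (n : ℕ) (g : ℕ → Obs K B) : ℝ :=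
  ∑ i ∈ (Finset.Iic n).disjSum (Finset.Iic n), M.coeffOf n (M.copy Q n) i * M.genOfHist g i

lemma coeFn_copy (Q : ℕ → Block K B) (n : ℕ) :
    M.copy Q n =ᵐ[E.law B] fun ω => M.simDev Q n (E.pathHist M.p ω) := by
  conv_lhs => rw [copy_eq_sum]
  exact coeFn_sum_smul fun i _ => M.coeFn_genVec i

lemma measurable_simDev (Q : ℕ → Block K B) (n : ℕ) : Measurable (M.simDev Q n) :=
  Finset.measurable_sum _ fun i _ => (M.measurable_genOfHist i).const_mul _

lemma simDev_congr {Q Q' : ℕ → Block K B} {n : ℕ} (h : ∀ s ≤ M.period n, Q s = Q' s) :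
    M.simDev Q n = M.simDev Q' n := by
  funext g
  rw [simDev, simDev, M.copy_congr h]

lemma simDev_eq_sum_source (Q : ℕ → Block K B) (n : ℕ) :
    ∃ (I : Finset (Option ℕ ⊕ ℕ)) (c : Option ℕ ⊕ ℕ → ℝ),
      ∀ ω, M.simDev Q n (E.pathHist M.p ω) = ∑ i ∈ I, c i * M.source i ω := by
  classical
  let f : ℕ ⊕ ℕ ↪ Option ℕ ⊕ ℕ :=
    ⟨Sum.map some id, Function.Injective.sumMap (Option.some_injective _) Function.injective_id⟩
  refine ⟨((Finset.Iic n).disjSum (Finset.Iic n)).map f,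
    fun i => M.coeffOf n (M.copy Q n) (Function.invFun f i), fun ω => ?_⟩
  rw [Finset.sum_map]
  refine Finset.sum_congr rfl fun i _ => ?_
  rw [genOfHist_pathHist]
  have h : Function.invFun f (f i) = i := Function.leftInverse_invFun f.injective i
  simp only [h]
  rfl

lemma integral_simDev (Q : ℕ → Block K B) (n : ℕ) :
    ∫ ω, M.simDev Q n (E.pathHist M.p ω) ∂(E.law B) = 0 := by
  obtain ⟨I, c, h⟩ := M.simDev_eq_sum_source Q n
  simp_rw [h]
  rw [integral_finsetSum]
  · simp [integral_const_mul, M.integral_source]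
  · exact fun i _ => ((M.isGaussianProcess_source.hasGaussianLaw_eval i).memLp_two.integrable
      (by norm_num)).const_mul _

/-- The target and the deviations of the observations made along the path `Q`. -/
noncomputable def actual (Q : ℕ → Block K B) (o : Option (ObsIndex K B)) (ω : Outcome K B) : ℝ :=
  o.elim (E.target M.w ω) fun i => if (i.2.2 : ℕ) < (Q i.1).1 i.2.1 then E.obsDev i ω else 0

/-- The target and the simulated deviations of the observations along the path `Q`. -/
noncomputable def simulated (Q : ℕ → Block K B) (o : Option (ObsIndex K B)) (ω : Outcome K B) : ℝ :=
  o.elim (E.target M.w ω) fun i => M.simDev Q (M.idx i) (E.pathHist M.p ω)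

lemma isLinear_actual (Q : ℕ → Block K B) (o : Option (ObsIndex K B)) :
    E.IsLinear (M.actual Q o) := by
  cases o with
  | none => exact isLinear_target _
  | some i =>
    by_cases h : (i.2.2 : ℕ) < (Q i.1).1 i.2.1
    · have : M.actual Q (some i) = E.obsDev i := funext fun ω => if_pos h
      rw [this]; exact isLinear_obsDev i
    · have : M.actual Q (some i) = fun _ => 0 := funext fun ω => if_neg h
      rw [this]; exact isLinear_zero

lemma coeFn_obsSeq (Q : ℕ → Block K B) (i : ObsIndex K B) :
    M.obsSeq Q (M.idx i) =ᵐ[E.law B] M.actual Q (some i) := by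
  by_cases h : (i.2.2 : ℕ) < (Q i.1).1 i.2.1
  · have h1 : M.actual Q (some i) = E.obsDev i := funext fun ω => if_pos h
    have h2 : M.obsSeq Q (M.idx i) = E.obsVec i := by
      simp only [obsSeq, Equiv.symm_apply_apply, if_pos h]
    rw [h1, h2]; exact E.coeFn_obsVec i
  · have h1 : M.actual Q (some i) = fun _ => 0 := funext fun ω => if_neg h
    have h2 : M.obsSeq Q (M.idx i) = 0 := by
      simp only [obsSeq, Equiv.symm_apply_apply, if_neg h]
    rw [h1, h2]; exact Lp.coeFn_zero ℝ 2 _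

lemma isGaussianProcess_simulated (Q : ℕ → Block K B) :
    IsGaussianProcess (M.simulated Q) (E.law B) := by
  refine isGaussianProcess_of_sum M.isGaussianProcess_source fun o => ?_
  cases o with
  | none => exact ⟨{Sum.inl none}, fun _ => 1, fun ω => by simp [simulated, source, core]⟩
  | some i => exact M.simDev_eq_sum_source Q _

lemma measurable_simulated (Q : ℕ → Block K B) (o : Option (ObsIndex K B)) :
    Measurable (M.simulated Q o) := by
  cases o with
  | none => exact E.measurable_target M.w
  | some i => exact (M.measurable_simDev Q _).comp (measurable_pathHist M.p)

/-- Both processes are centred Gaussian, and the copies were built to have the same inner products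
with each other and with the target. -/
lemma map_actual_eq_map_simulated (Q : ℕ → Block K B) :
    (E.law B).map (fun ω o => M.actual Q o ω) = (E.law B).map (fun ω o => M.simulated Q o ω) := by
  refine map_eq_of_isGaussianProcess (isGaussianProcess_of_isLinear (M.isLinear_actual Q))
    (M.isGaussianProcess_simulated Q) (fun o => (M.isLinear_actual Q o).measurable)
    (M.measurable_simulated Q) (fun o => (M.isLinear_actual Q o).integral) (fun o => ?_)
    fun o o' => ?_
  · cases o with
    | none => exact (isLinear_target M.w).integral
    | some i => exact M.integral_simDev Q _
  · let a : Option (ObsIndex K B) → Lp ℝ 2 (E.law B) :=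
      fun o => o.elim (E.targetVec M.w) fun i => M.obsSeq Q (M.idx i)
    let b : Option (ObsIndex K B) → Lp ℝ 2 (E.law B) :=
      fun o => o.elim (E.targetVec M.w) fun i => M.copy Q (M.idx i)
    have ha : ∀ o, a o =ᵐ[E.law B] M.actual Q o := by
      rintro (_ | i)
      · exact E.coeFn_targetVec _
      · exact M.coeFn_obsSeq Q i
    have hb : ∀ o, b o =ᵐ[E.law B] M.simulated Q o := by
      rintro (_ | i)
      · exact E.coeFn_targetVec _
      · exact M.coeFn_copy Q _
    rw [integral_mul_eq_inner (ha o) (ha o'), integral_mul_eq_inner (hb o) (hb o')]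
    rcases o with _ | i <;> rcases o' with _ | i'
    · rfl
    · exact (M.inner_targetVec_copy Q _).symm
    · have := M.inner_targetVec_copy Q (M.idx i)
      simp only [a, b, Option.elim]
      rw [real_inner_comm, ← this, real_inner_comm]
    · exact (M.inner_copy_copy Q _ _).symm

/-- The world whose realizations are simulated from those along the path `M.p`. -/
noncomputable def simWorld : World K B (ℕ → Obs K B) := fun t q g k j =>
  if (j : ℕ) < (q (Fin.last t)).1 k then
    E.signalMean k +
      -- Choices up to t are extended to a path by repeating the last one. By `simDev_congr`, an
      -- observation of period t does not see the extension.
      M.simDev (fun s => q ⟨min s t, Nat.lt_succ_of_le (min_le_right s t)⟩) (M.idx (t, k, j)) g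
  else 0

lemma measurable_simWorld (t : ℕ) (q : Fin (t + 1) → Block K B) : Measurable (M.simWorld t q) := by
  refine measurable_pi_iff.2 fun k => measurable_pi_iff.2 fun j => ?_
  simp only [simWorld]
  split_ifs
  · exact measurable_const.add (M.measurable_simDev _ _)
  · exact measurable_const

lemma simWorld_congr {g g' : ℕ → Obs K B} {t : ℕ} (h : ∀ s ≤ t, g s = g' s)
    (q : Fin (t + 1) → Block K B) : M.simWorld t q g = M.simWorld t q g' := by
  funext k j
  simp only [simWorld, simDev]
  congr 2
  refine Finset.sum_congr rfl fun i hi => ?_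
  rw [M.genOfHist_congr (t := t) (by simp [period]) h hi]

lemma along_simWorld (Q : ℕ → Block K B) (g : ℕ → Obs K B) (t : ℕ) (k : Fin K) (j : Fin B) :
    M.simWorld.along Q g t k j =
      if (j : ℕ) < (Q t).1 k then E.signalMean k + M.simDev Q (M.idx (t, k, j)) g else 0 := by
  simp only [World.along, simWorld, Fin.val_last]
  rw [M.simDev_congr (Q' := Q)]
  intro s hs
  have : s ≤ t := by simpa [period] using hs
  simp [this]

variable [NeZero K]

/-- Along every path, the simulated realizations have the same joint law with the payoff-relevant
state as the actual ones. -/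
lemma map_pathHist_eq_map_along_simWorld (hw : ∀ ω : Outcome K B, ω.1 0 - E.mean 0 = E.target M.w ω)
    (Q : ℕ → Block K B) :
    (E.law B).map (fun ω => (ω.1 0, E.pathHist Q ω)) =
      (E.law B).map (fun ω => (ω.1 0, M.simWorld.along Q (E.pathHist M.p ω))) := by
  let F : (Option (ObsIndex K B) → ℝ) → ℝ × (ℕ → Obs K B) := fun f =>
    (E.mean 0 + f none, fun t k j =>
      if (j : ℕ) < (Q t).1 k then E.signalMean k + f (some (t, k, j)) else 0)
  have hF : Measurable F := by
    refine Measurable.prodMk (by fun_prop) (measurable_pi_iff.2 fun t => measurable_pi_iff.2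
      fun k => measurable_pi_iff.2 fun j => ?_)
    split_ifs
    · fun_prop
    · fun_prop
  have hmean : ∀ ω : Outcome K B, ω.1 0 = E.mean 0 + E.target M.w ω := fun ω => by
    rw [← hw]; ring
  have h1 : (fun ω : Outcome K B => (ω.1 0, E.pathHist Q ω)) =
      F ∘ fun ω o => M.actual Q o ω := by
    funext ω
    refine Prod.ext (hmean ω) (funext fun t => funext fun k => funext fun j => ?_)
    simp only [Environment.pathHist, signal_apply, F, Function.comp_apply, actual, Option.elim]
    split_ifs <;> rfl
  have h2 : (fun ω : Outcome K B => (ω.1 0, M.simWorld.along Q (E.pathHist M.p ω))) =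
      F ∘ fun ω o => M.simulated Q o ω := by
    funext ω
    exact Prod.ext (hmean ω) (funext fun t => funext fun k => funext fun j =>
      M.along_simWorld Q _ t k j)
  rw [h1, h2, ← Measure.map_map hF
      (measurable_pi_iff.2 fun o => (M.isLinear_actual Q o).measurable),
    ← Measure.map_map hF (measurable_pi_iff.2 (M.measurable_simulated Q)),
    M.map_actual_eq_map_simulated]

/-- Any strategy can be replaced by one that follows the path `M.p`, with the same expected
payoff. -/
lemma exists_expectedPayoff_eq (hw : ∀ ω : Outcome K B, ω.1 0 - E.mean 0 = E.target M.w ω)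
    {A : ℕ → Type*} [∀ t, MeasurableSpace (A t)] {U : (∀ t, A t) → ℝ → ℝ}
    (hU : Measurable fun x : (∀ t, A t) × ℝ => U x.1 x.2) (S : AcqStrategy K B)
    (D : DecisionStrategy K B A) :
    ∃ D' : DecisionStrategy K B A,
      expectedPayoff E U S D = expectedPayoff E U (AcqStrategy.ofPath M.p) D' := by
  have : Nonempty (Block K B) := ⟨M.p 0⟩
  let W : World K B (Outcome K B) := fun t q ω => M.simWorld t q (E.pathHist M.p ω)
  have hW : ∀ t q, Measurable (W t q) := fun t q =>
    (M.measurable_simWorld t q).comp (measurable_pathHist M.p)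
  have hu : Measurable fun ω : Outcome K B => ω.1 0 := by fun_prop
  have hlaw := map_adapted_eq (μ := E.law B) (W := E.world) (W' := W) E.measurable_world hW hu
    (fun Q => M.map_pathHist_eq_map_along_simWorld hw Q) S
  -- The finite history is prolonged by repeating its last entry; `simWorld_congr` shows that the
  -- prolongation is never read.
  let ext (t : ℕ) (h : Fin (t + 1) → Obs K B) : ℕ → Obs K B :=
    fun s => h ⟨min s t, Nat.lt_succ_of_le (min_le_right s t)⟩
  have hext : ∀ t, Measurable (ext t) := fun t =>
    measurable_pi_iff.2 fun s => measurable_pi_apply _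
  -- The new decision maker simulates the run of S from the observed history and acts as D would; no
  -- outside randomization is needed.
  let D' : DecisionStrategy K B A :=
    { act := fun t h => D.act t fun s => M.simWorld.adapted S (ext t h) s
      measurable_act := fun t => (D.measurable_act t).comp (measurable_pi_iff.2 fun s =>
        (World.measurable_adapted M.measurable_simWorld S s).comp (hext t)) }
  let G : ℝ × (ℕ → Obs K B) → ℝ := fun x =>
    U (fun t => D.act t fun s : Fin (t + 1) => x.2 s) x.1
  have hG : Measurable G := by
    refine hU.comp (Measurable.prodMk (measurable_pi_iff.2 fun t =>
      (D.measurable_act t).comp ?_) measurable_fst)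
    exact measurable_pi_iff.2 fun s => (measurable_pi_apply (s : ℕ)).comp measurable_snd
  have h1 : ∀ ω, payoff E U S D ω = G (ω.1 0, E.world.adapted S ω) := fun ω => by
    simp only [payoff, history_eq_adapted, G]
  have h2 : ∀ ω, payoff E U (AcqStrategy.ofPath M.p) D' ω = G (ω.1 0, W.adapted S ω) := fun ω => by
    simp only [payoff, history_ofPath, G, D']
    congr 1
    funext t
    congr 1
    funext s
    refine World.adapted_congr M.simWorld W S (T := t + 1) (fun r hr q => ?_) s s.2
    refine M.simWorld_congr (fun i hi => ?_) q
    have : i ≤ t := by omega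
    simp [ext, this]
  have hmW : Measurable fun ω => (ω.1 0, W.adapted S ω) :=
    hu.prodMk (measurable_pi_iff.2 fun t => World.measurable_adapted hW S t)
  have hmE : Measurable fun ω : Outcome K B => (ω.1 0, E.world.adapted S ω) :=
    hu.prodMk (measurable_pi_iff.2 fun t => World.measurable_adapted E.measurable_world S t)
  have key : ∀ φ : ℝ → ℝ≥0∞, Measurable φ →
      ∫⁻ ω, φ (payoff E U S D ω) ∂E.law B =
        ∫⁻ ω, φ (payoff E U (AcqStrategy.ofPath M.p) D' ω) ∂E.law B := fun φ hφ => by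
    simp_rw [h1, h2]
    have hE := lintegral_map (μ := E.law B) (hφ.comp hG) hmE
    rw [hlaw, lintegral_map (hφ.comp hG) hmW] at hE
    exact hE.symm
  refine ⟨D', ?_⟩
  simp only [expectedPayoff]
  rw [key _ ENNReal.measurable_ofReal,
    key (fun x => ENNReal.ofReal (-x)) (ENNReal.measurable_ofReal.comp measurable_neg)]

end Simulator

/-! ### Consequences of non-redundancy -/

section NonRedundant

variable {K : ℕ} [NeZero K] {E : Environment K}

lemma Environment.NonRedundant.isUnit_C (hE : E.NonRedundant) : IsUnit E.C := by
  have h := hE.1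
  rw [Matrix.rank_eq_finrank_span_row] at h
  have hli : LinearIndependent ℝ E.C.row := by
    rw [linearIndependent_iff_card_eq_finrank_span]
    simpa [Set.finrank] using h.symm
  exact Matrix.linearIndependent_rows_iff_isUnit.1 hli

lemma Environment.NonRedundant.signalCov_posDef (hE : E.NonRedundant) : E.signalCov.PosDef := by
  have h := E.cov_posDef.mul_mul_conjTranspose_same (B := E.C)
    (Matrix.vecMul_injective_of_isUnit hE.isUnit_C)
  rwa [Matrix.conjTranspose_eq_transpose_of_trivial] at h

/-- The payoff-relevant state is a combination of the signals in which every source occurs. -/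
lemma Environment.NonRedundant.exists_coeff (hE : E.NonRedundant) :
    ∃ w : Fin K → ℝ, (∀ k, w k ≠ 0) ∧ w ᵥ* E.C = Pi.single 0 1 := by
  have hdet := (Matrix.isUnit_iff_isUnit_det _).1 hE.isUnit_C
  have hw : (Pi.single 0 1 ᵥ* E.C⁻¹) ᵥ* E.C = (Pi.single 0 1 : Fin K → ℝ) := by
    rw [Matrix.vecMul_vecMul, Matrix.nonsing_inv_mul _ hdet, Matrix.vecMul_one]
  refine ⟨Pi.single 0 1 ᵥ* E.C⁻¹, fun k hk => ?_, hw⟩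
  -- If w k were 0, the remaining rows would already span the first coordinate vector.
  refine hE.2 {k}ᶜ (by simp) ?_
  rw [← hw, Matrix.vecMul_eq_sum]
  refine Submodule.sum_mem _ fun i _ => ?_
  by_cases hi : i = k
  · rw [hi, hk, zero_smul]; exact Submodule.zero_mem _
  · exact Submodule.smul_mem _ _ (Submodule.subset_span ⟨i, hi, rfl⟩)

lemma sub_mean_eq_target {w : Fin K → ℝ} (hw : w ᵥ* E.C = Pi.single 0 1) {B : ℕ}
    (ω : Outcome K B) : ω.1 0 - E.mean 0 = E.target w ω := by
  have h : ∀ i, ∑ k, w k * E.C k i = (Pi.single 0 1 : Fin K → ℝ) i := fun i => congrFun hw i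
  simp only [Environment.target, Environment.stateDev, Finset.mul_sum]
  rw [Finset.sum_comm]
  simp_rw [← mul_assoc, ← Finset.sum_mul, h]
  simp [Pi.single_apply]

end NonRedundant

/-! ### The optimal path and its myopia -/

section Path

variable {K B : ℕ}

lemma sum_totalCount (Q : ℕ → Block K B) (T : ℕ) : ∑ k, totalCount Q T k = B * T := by
  simp only [totalCount]
  rw [Finset.sum_comm, Finset.sum_congr rfl fun t _ => (Q t).2]
  simp [mul_comm]

/-- A monotone sequence of allocations is generated by a path of multisets. -/
lemma exists_totalCount_eq {N : ℕ → Fin K → ℕ} (hN : Monotone N) (hsum : ∀ t, ∑ k, N t k = B * t) :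
    ∃ p : ℕ → Block K B, ∀ T, totalCount p T = N T := by
  refine ⟨fun t => ⟨fun k => N (t + 1) k - N t k, ?_⟩, fun T => funext fun k => ?_⟩
  · rw [Finset.sum_tsub_distrib _ fun k _ => hN (Nat.le_succ t) k, hsum, hsum, Nat.mul_succ,
      Nat.add_sub_cancel_left]
  · have h0 : N 0 k = 0 := by
      have := hsum 0
      rw [mul_zero, Finset.sum_eq_zero_iff] at this
      exact this k (Finset.mem_univ k)
    rw [totalCount, Finset.sum_range_tsub fun _ _ h => hN h k, h0, Nat.sub_zero]

/-- Pigeonhole; applied to the first period, it provides the two observations whose difference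
serves as the source of randomness. -/
lemma Block.exists_two_le (h : K < B) (q : Block K B) : ∃ k, 2 ≤ q.1 k := by
  by_contra! hq
  have : ∑ k, q.1 k ≤ ∑ _k : Fin K, 1 := Finset.sum_le_sum fun k _ => Nat.le_of_lt_succ (hq k)
  rw [q.2] at this
  simp at this
  omega

/-- A one-period deviation from a path is again a path, and `hp` compares with all paths, not only
with such deviations. -/
lemma isMyopic_ofPath [NeZero K] {E : Environment K} {w : Fin K → ℝ} (hS : E.signalCov.PosDef)
    (hw : ∀ ω : Outcome K B, ω.1 0 - E.mean 0 = E.target w ω) {p : ℕ → Block K B}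
    (hp : ∀ T (Q : ℕ → Block K B), allocVar E.signalCov⁻¹ w E.noise (totalCount p T) ≤
      allocVar E.signalCov⁻¹ w E.noise (totalCount Q T)) :
    (AcqStrategy.ofPath p).IsMyopic E := by
  intro t q
  rw [deviate_ofPath]
  filter_upwards [posteriorVariance_ofPath hS hw p (t + 1),
    posteriorVariance_ofPath hS hw (Function.update p t q) (t + 1)] with ω h1 h2
  rw [h1, h2]
  exact hp _ _

end Path

end MyopicInfo

/-- For every large enough block size there is a (history-independent) myopic information
acquisition strategy that is optimal for every decision problem: whatever the payoff function, it
can be completed by a decision strategy to do at least as well as any given strategy, and to be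
optimal if an optimal strategy exists at all. -/
theorem theorem1 {K : ℕ} [NeZero K] (E : Environment K) (hE : E.NonRedundant) :
    ∃ B₀ : ℕ, ∀ B : ℕ, B₀ ≤ B →
      ∃ p : ℕ → Block K B,
        (AcqStrategy.ofPath p).IsMyopic E ∧
        ∀ (A : ℕ → Type*) [∀ t, MeasurableSpace (A t)] (U : (∀ t, A t) → ℝ → ℝ),
          Measurable (fun x : (∀ t, A t) × ℝ => U x.1 x.2) →
            (∀ (S : AcqStrategy K B) (D : DecisionStrategy K B A),
              ∃ D' : DecisionStrategy K B A,
                expectedPayoff E U S D ≤ expectedPayoff E U (AcqStrategy.ofPath p) D') ∧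
            ((∃ (S : AcqStrategy K B) (D : DecisionStrategy K B A), IsOptimal E U S D) →
              ∃ D' : DecisionStrategy K B A, IsOptimal E U (AcqStrategy.ofPath p) D') := by
  have hS := hE.signalCov_posDef
  obtain ⟨w, hw0, hwC⟩ := hE.exists_coeff
  obtain ⟨B₁, hB₁⟩ := exists_monotone_isMinAlloc hS.inv hw0 E.noise_pos
  -- `B₁` makes the optimal allocations nested; `K + 1` forces some source to be observed twice in
  -- the first period.
  refine ⟨max B₁ (K + 1), fun B hB => ?_⟩
  obtain ⟨N, hN, hmin⟩ := hB₁ B ((le_max_left _ _).trans hB)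
  have hKB : K < B := (le_max_right _ _).trans hB
  obtain ⟨p, hp⟩ := exists_totalCount_eq hN fun t => (hmin t).1
  have hopt : ∀ T (Q : ℕ → Block K B), allocVar E.signalCov⁻¹ w E.noise (totalCount p T) ≤
      allocVar E.signalCov⁻¹ w E.noise (totalCount Q T) := fun T Q => by
    rw [hp]
    exact (hmin T).2 _ (sum_totalCount Q T)
  have : NeZero B := ⟨by omega⟩
  obtain ⟨e, he⟩ := exists_obsIndexEquiv K B
  obtain ⟨k₀, hk₀⟩ := Block.exists_two_le hKB (p 0)
  have hv : E.noiseVar k₀ + E.noiseVar k₀ ≠ 0 :=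
    (add_pos (E.noiseVar_pos k₀) (E.noiseVar_pos k₀)).ne'
  obtain ⟨ζ, hζ, hζ'⟩ := exists_map_gaussianReal_eq_infinitePi hv
  have hB2 : 2 ≤ B := hk₀.trans (Block.le (p 0) k₀)
  let M : Simulator E B :=
    { w := w, p := p, idx := e, k₀ := k₀, j₀ := ⟨0, by omega⟩, j₁ := ⟨1, by omega⟩, ζ := ζ
      signalCov_posDef := hS
      optimal := hopt
      idx_mono := he
      j_ne := by simp
      j₀_lt := by simp only; omega
      j₁_lt := by simp only; omega
      measurable_ζ := hζ
      map_ζ := hζ' }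
  refine ⟨p, isMyopic_ofPath hS (sub_mean_eq_target hwC) hopt, fun A _ U hU => ?_⟩
  have key := M.exists_expectedPayoff_eq (sub_mean_eq_target hwC) hU
  refine ⟨fun S D => (key S D).imp fun D' h => h.le, ?_⟩
  rintro ⟨S, D, hSD⟩
  obtain ⟨D', h⟩ := key S D
  exact ⟨D', fun S' D'' => (hSD S' D'').trans h.le⟩
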